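/- Let $k$ be a field, $G$ a group with unit $\epsilon$, and $\Phi\colon G^3\to k^*$ a normalized 3-cocycle, i.e. $\Phi(e,f,g)\Phi(e,fg,h)\Phi(f,g,h)=\Phi(ef,g,h)\Phi(e,f,gh)$ and $\Phi=1$ as soon as one argument is $\epsilon$. For a 2-cochain $F\colon G^2\to k^*$ put $\partial F(e,f,g)=\frac{F(e,f)F(ef,g)}{F(e,fg)F(f,g)}$; $F$ is a *gauge transformation on $G$* if $F(g,\epsilon)=F(\epsilon,g)=1$ for all $g$, and then $\Phi_F:=\Phi\,\partial F$. The cocycle $\Phi$ is a *3-coboundary* if $\Phi=\partial F$ for some 2-cochain $F$. A *$(kG,\Phi)$-Majid bimodule* is a $kG$-bicomodule $M$ (equivalently $M=\bigoplus_{g,h\in G}{}^gM^h$) with bicomodule maps $kG\otimes M\to M$, $M\otimes kG\to M$ such that $\epsilon.m=m=m.\epsilon$ and, for $m\in{}^gM^h$, $$e.(f.m)=\tfrac{\Phi(e,f,g)}{\Phi(e,f,h)}(ef).m,\quad (m.e).f=\tfrac{\Phi(h,e,f)}{\Phi(g,e,f)}m.(ef),\quad (e.m).f=\tfrac{\Phi(e,h,f)}{\Phi(e,g,f)}e.(m.f).$$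 For $\Phi=1$ it is a *$kG$-Hopf bimodule*. Given a gauge transformation $F$ on $G$, $M_F$ is the $(kG,\Phi_F)$-Majid bimodule with the same bicomodule and $f._Fm=\frac{F(f,h)}{F(f,g)}f.m$, $m._Ff=\frac{F(h,f)}{F(g,f)}m.f$ for $m\in{}^gM^h$. A $(kG,\Phi)$-Majid bimodule $M$ and a $(kG,\Phi')$-Majid bimodule $N$ are *gauge equivalent* if $\Phi'=\Phi_F$ and $M_F\cong N$ for some $F$. For each conjugacy class $C$ of $G$ fix $g(C)\in C$, with centralizer $Z_C$. A *$\Phi$-collection* is a family $(V_C)_C$ where $V_C$ is a projective representation of $Z_C$ with 2-cocycle $\tilde\Phi_C(e,f)=\tilde\Phi(e,f,g(C))$, where $$\tilde\Phi(e,f,g)=\frac{\Phi(e,f,g)\Phi(ef,f^{-1},e^{-1})\Phi(e,fg,f^{-1})}{\Phi(efg,f^{-1},e^{-1})\Phi(e,f,f^{-1})}.$$ Families of linear representations of the groups $Z_C$ are exactly the collections for the trivial 3-cocycle, and are regarded as such. The $\Phi$-collection $(M_C)$ of $M$ is given by $M_C={}^{g(C)}M^{\epsilon}$ with $f\triangleright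 m=(f.m).f^{-1}$. For a gauge transformation $F$ on $G$ let $\mu^F_C(f)=\frac{F(f,f^{-1})}{F(f,g(C))F(fg(C),f^{-1})}$ ($f\in Z_C$), and let $(V^F_C)$ be the $\Phi_F$-collection obtained by multiplying the action of $f$ on $V_C$ by $\mu^F_C(f)$. A $\Phi$-collection $(V_C)$ and a $\Phi'$-collection $(W_C)$ are *gauge equivalent* if, for some $F$, $\Phi'=\Phi_F$ and $V^F_C\cong W_C$ for all $C$; they are *uniformly projective equivalent* if, for some $F$, $\Phi'=\Phi\,\partial F$ and, for every $C$, $W_C$ is projectively equivalent to $V_C$ via the scalar function $\mu^F_C$ (i.e. $\rho_{W_C}(f)=\mu_C^F(f)\,\phi\rho_{V_C}(f)\phi^{-1}$ for a linear isomorphism $\phi$). Let $Q$ be the quiver with vertex set $G$ whose arrows from $h$ to $g$ form a basis of ${}^gM^h$. $H(M)$ is the graded Majid algebra on the path coalgebra $kQ$ with unit $\epsilon$, with reassociator equal to $\Phi$ on vertices and $0$ if one argument is a path of positive length, and with product $$a_m\cdots a_1\cdot b_n\cdots b_1=\sum_d [p^d_{m+n}.q^d_{m+n}]\cdots[p^d_1.q^d_1],$$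 the sum running over all splittings of the two paths into $m+n$ successive vertices or arrows $p^d_i$, resp. $q^d_i$, such that for each $i$ exactly one of $p^d_i,q^d_i$ is an arrow; $[\,.\,]$ is the action of $G$ on $M$. $B(M)$ is the smallest sub Majid algebra of $H(M)$ containing all vertices and arrows. A *gauge transformation* on a Majid algebra $H$ is a convolution invertible $F\colon H\otimes H\to k$ with $F(h,1)=F(1,h)=\varepsilon(h)$; it yields the Majid algebra $H_F$ with product $F^{-1}(g_1,h_1)\,g_2h_2\,F(g_3,h_3)$ and reassociator $F^{-1}(g_1,h_1)F^{-1}(f_1,g_2h_2)\Phi(f_2,g_3,h_3)F(f_3g_4,h_4)F(f_4,g_5)$. $H$ and $H'$ are *gauge equivalent* if $H_F\cong H'$ for some $F$, by a coalgebra isomorphism preserving unit, product and reassociator. A Hopf algebra is regarded as a Majid algebra with trivial reassociator. **Statement.** For every $(kG,\Phi)$-Majid bimodule $M$ the following are equivalent: 1. $H(M)$ is gauge equivalent to a Hopf algebra. 2. $B(M)$ is gauge equivalent to a Hopf algebra. 3. $M$ is gauge equivalent to a $kG$-Hopf bimodule. 4. $\Phi$ is a 3-coboundary. 5. $(M_C)$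 is gauge equivalent to an admissible collection of linear representations (a collection for the trivial 3-cocycle). 6. $(M_C)$ is uniformly projective equivalent to a collection of linear representations (a collection for the trivial 3-cocycle). -/

import Mathlib

open scoped TensorProduct

universe u w

noncomputable section

namespace QuasiQuantum

/-! ### Cochains on groups -/

section Cocycles

variable {k G : Type*} [Field k] [Group G]

/-- The differential of a 2-cochain `F : G × G → kˣ`. -/
def differential (F : G → G → kˣ) (e f g : G) : kˣ :=
  F e f * F (e * f) g / (F e (f * g) * F f g)

variable (k G) in
/-- A normalized 3-cocycle on `G` with values in `kˣ` (trivial action). -/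
@[ext]
structure ThreeCocycle where
  /-- the underlying function -/
  toFun : G → G → G → kˣ
  cocycle : ∀ e f g h : G,
    toFun e f g * toFun e (f * g) h * toFun f g h = toFun (e * f) g h * toFun e f (g * h)
  one_left : ∀ e f : G, toFun 1 e f = 1
  one_mid : ∀ e f : G, toFun e 1 f = 1
  one_right : ∀ e f : G, toFun e f 1 = 1

instance : CoeFun (ThreeCocycle k G) (fun _ => G → G → G → kˣ) := ⟨ThreeCocycle.toFun⟩

variable (k G) in
/-- A gauge transformation on the group `G`: a normalized 2-cochain with values in `kˣ`
(convolution invertibility is automatic, since the values are units). -/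
structure GroupGauge where
  /-- the underlying function -/
  toFun : G → G → kˣ
  one_left : ∀ g : G, toFun 1 g = 1
  one_right : ∀ g : G, toFun g 1 = 1

instance : CoeFun (GroupGauge k G) (fun _ => G → G → kˣ) := ⟨GroupGauge.toFun⟩

variable (k G) in
/-- The trivial 3-cocycle. -/
def ThreeCocycle.trivial : ThreeCocycle k G where
  toFun _ _ _ := 1
  cocycle := by simp
  one_left := by simp
  one_mid := by simp
  one_right := by simp

/-- The 3-cocycle `Φ_F = Φ ∂F`. -/
def ThreeCocycle.twist (Φ : ThreeCocycle k G) (F : GroupGauge k G) : ThreeCocycle k G where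
  toFun e f g := differential F e f g * Φ e f g
  cocycle e f g h := by
    have := Φ.cocycle e f g h
    have h' := congrArg (fun u : kˣ => (u : k)) this
    apply Units.ext
    simp only [differential, Units.val_mul, Units.val_div_eq_div_val, mul_assoc] at h' ⊢
    field_simp
    linear_combination h'
  one_left e f := by simp [differential, F.one_left, Φ.one_left]
  one_mid e f := by simp [differential, F.one_left, F.one_right, Φ.one_mid]
  one_right e f := by simp [differential, F.one_right, Φ.one_right]

/-- `Φ` is a 3-coboundary: it is the differential of some 2-cochain. -/
def ThreeCocycle.IsCoboundary (Φ : ThreeCocycle k G) : Prop :=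
  ∃ F : G → G → kˣ, ∀ e f g : G, Φ e f g = differential F e f g

/-- The function `Φ̃(e, f, g)` attached to a 3-cocycle. -/
def ThreeCocycle.tilde (Φ : ThreeCocycle k G) (e f g : G) : kˣ :=
  Φ e f g * Φ (e * f) f⁻¹ e⁻¹ * Φ e (f * g) f⁻¹ /
    (Φ (e * f * g) f⁻¹ e⁻¹ * Φ e f f⁻¹)

/-- The centralizer `Z_g` of an element of `G`. -/
abbrev Cent (g : G) : Subgroup G := Subgroup.centralizer {g}

/-- The restriction of `Φ̃(-, -, g)` to `Z_g`. -/
def ThreeCocycle.tildeCent (Φ : ThreeCocycle k G) (g : G) (e f : Cent g) : kˣ :=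
  Φ.tilde e f g

/-- The scalar `F(f, f⁻¹) / (F(f, g) F(fg, f⁻¹))` for `f ∈ Z_g`. -/
def GroupGauge.mu (F : GroupGauge k G) (g : G) (f : Cent g) : kˣ :=
  F f (f : G)⁻¹ / (F f g * F (f * g) (f : G)⁻¹)

theorem GroupGauge.mu_one (F : GroupGauge k G) (g : G) : F.mu g 1 = 1 := by
  simp [GroupGauge.mu, F.one_left, F.one_right]

theorem ThreeCocycle.tildeCent_twist (Φ : ThreeCocycle k G) (F : GroupGauge k G) (g : G)
    (e f : Cent g) :
    (Φ.twist F).tildeCent g e f * F.mu g (e * f) =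
      F.mu g e * F.mu g f * Φ.tildeCent g e f := by
  obtain ⟨e, he⟩ := e
  obtain ⟨f, hf⟩ := f
  have hf1 : f * g * f⁻¹ = g := by
    rw [Subgroup.mem_centralizer_singleton_iff.1 hf]; group
  have hf3 : f * (g * f⁻¹) = g := by rw [← mul_assoc, hf1]
  apply Units.ext
  simp only [ThreeCocycle.tildeCent, ThreeCocycle.tilde, ThreeCocycle.twist, differential,
    GroupGauge.mu, Units.val_mul, Units.val_div_eq_div_val, Subgroup.coe_mul, mul_inv_rev,
    mul_assoc, hf3, mul_inv_cancel, F.one_right, mul_one, Units.val_one]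
  field_simp

end Cocycles

/-! ### Majid bimodules over `(kG, Φ)` -/

section Bimodules

variable {k G : Type*} [Field k]

/-- The linear extension of a function on `G` to the group algebra. -/
def linExt (φ : G → k) : MonoidAlgebra k G →ₗ[k] k :=
  Finsupp.linearCombination k φ ∘ₗ (MonoidAlgebra.coeffLinearEquiv k).toLinearMap

@[simp] theorem linExt_single (φ : G → k) (g : G) (a : k) :
    linExt φ (MonoidAlgebra.single g a) = a * φ g := by
  simp [linExt]

section Contr

variable {M : Type*} [AddCommGroup M] [Module k M]

/-- In Sweedler notation, `m ↦ φ(m⁻¹) m⁰` for a left coaction `m ↦ m⁻¹ ⊗ m⁰`. -/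
def contrL (δ : M →ₗ[k] MonoidAlgebra k G ⊗[k] M) (φ : G → k) : M →ₗ[k] M :=
  (TensorProduct.lid k M).toLinearMap ∘ₗ (linExt φ).rTensor M ∘ₗ δ

/-- In Sweedler notation, `m ↦ m₀ φ(m₁)` for a right coaction `m ↦ m₀ ⊗ m₁`. -/
def contrR (δ : M →ₗ[k] M ⊗[k] MonoidAlgebra k G) (φ : G → k) : M →ₗ[k] M :=
  (TensorProduct.rid k M).toLinearMap ∘ₗ (linExt φ).lTensor M ∘ₗ δ

end Contr

variable [Group G]

/-- A `(kG, Φ)`-Majid bimodule structure on `M`: a `kG`-bicomodule with two bicomodule morphisms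
`kG ⊗ M → M` and `M ⊗ kG → M` which are unital and quasi-associative. The two morphisms are given
by their values at the basis elements `g ∈ G` of `kG`: `lact g m = g.m` and `ract g m = m.g`. -/
structure MajidBimodule (Φ : ThreeCocycle k G) (M : Type*) [AddCommGroup M] [Module k M] where
  /-- the left coaction -/
  coactL : M →ₗ[k] MonoidAlgebra k G ⊗[k] M
  /-- the right coaction -/
  coactR : M →ₗ[k] M ⊗[k] MonoidAlgebra k G
  coassocL : ∀ m, TensorProduct.assoc k _ _ _ ((Coalgebra.comul (R := k)).rTensor M (coactL m)) =
    coactL.lTensor _ (coactL m)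
  counitL : ∀ m, TensorProduct.lid k M ((Coalgebra.counit (R := k)).rTensor M (coactL m)) = m
  coassocR : ∀ m, TensorProduct.assoc k _ _ _ (coactR.rTensor _ (coactR m)) =
    (Coalgebra.comul (R := k)).lTensor M (coactR m)
  counitR : ∀ m, TensorProduct.rid k M ((Coalgebra.counit (R := k)).lTensor M (coactR m)) = m
  bicomodule : ∀ m, TensorProduct.assoc k _ _ _ (coactL.rTensor _ (coactR m)) =
    coactR.lTensor _ (coactL m)
  /-- the left action of group elements -/
  lact : G → M →ₗ[k] M
  /-- the right action of group elements -/
  ract : G → M →ₗ[k] M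
  coactL_lact : ∀ g m, coactL (lact g m) =
    TensorProduct.map (LinearMap.mulLeft k (MonoidAlgebra.single g 1)) (lact g) (coactL m)
  coactR_lact : ∀ g m, coactR (lact g m) =
    TensorProduct.map (lact g) (LinearMap.mulLeft k (MonoidAlgebra.single g 1)) (coactR m)
  coactL_ract : ∀ g m, coactL (ract g m) =
    TensorProduct.map (LinearMap.mulRight k (MonoidAlgebra.single g 1)) (ract g) (coactL m)
  coactR_ract : ∀ g m, coactR (ract g m) =
    TensorProduct.map (ract g) (LinearMap.mulRight k (MonoidAlgebra.single g 1)) (coactR m)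
  one_lact : ∀ m, lact 1 m = m
  one_ract : ∀ m, ract 1 m = m
  /-- `g.(h.m₀) Φ(g, h, m₁) = Φ(g, h, m⁻¹) (gh).m⁰` -/
  lact_lact : ∀ g h m, lact g (lact h (contrR coactR (fun x => (Φ g h x : k)) m)) =
    lact (g * h) (contrL coactL (fun x => (Φ g h x : k)) m)
  /-- `m₀.(gh) Φ(m₁, g, h) = Φ(m⁻¹, g, h) (m⁰.g).h` -/
  ract_ract : ∀ g h m, ract (g * h) (contrR coactR (fun x => (Φ x g h : k)) m) =
    ract h (ract g (contrL coactL (fun x => (Φ x g h : k)) m))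
  /-- `g.(m₀.h) Φ(g, m₁, h) = Φ(g, m⁻¹, h) (g.m⁰).h` -/
  lact_ract : ∀ g h m, lact g (ract h (contrR coactR (fun x => (Φ g x h : k)) m)) =
    ract h (lact g (contrL coactL (fun x => (Φ g x h : k)) m))

namespace MajidBimodule

variable {Φ : ThreeCocycle k G} {M : Type*} [AddCommGroup M] [Module k M]
  (B : MajidBimodule Φ M)

/-- The isotypic component `ᵍMʰ`. -/
def comp (g h : G) : Submodule k M where
  carrier := {m | B.coactL m = MonoidAlgebra.single g 1 ⊗ₜ m ∧
    B.coactR m = m ⊗ₜ MonoidAlgebra.single h 1}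
  add_mem' := by
    rintro a b ⟨h1, h2⟩ ⟨h3, h4⟩
    simp [h1, h2, h3, h4, TensorProduct.tmul_add, TensorProduct.add_tmul]
  zero_mem' := by simp
  smul_mem' := by
    rintro c a ⟨h1, h2⟩
    simp [h1, h2, TensorProduct.smul_tmul']

theorem mem_comp {g h : G} {m : M} : m ∈ B.comp g h ↔
    B.coactL m = MonoidAlgebra.single g 1 ⊗ₜ m ∧
    B.coactR m = m ⊗ₜ MonoidAlgebra.single h 1 := Iff.rfl

variable {B}

theorem lact_mem {g h : G} {m : M} (hm : m ∈ B.comp g h) (f : G) :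
    B.lact f m ∈ B.comp (f * g) (f * h) := by
  obtain ⟨h1, h2⟩ := hm
  constructor
  · rw [B.coactL_lact, h1]; simp
  · rw [B.coactR_lact, h2]; simp

theorem ract_mem {g h : G} {m : M} (hm : m ∈ B.comp g h) (f : G) :
    B.ract f m ∈ B.comp (g * f) (h * f) := by
  obtain ⟨h1, h2⟩ := hm
  constructor
  · rw [B.coactL_ract, h1]; simp
  · rw [B.coactR_ract, h2]; simp

theorem contrL_comp {g h : G} {m : M} (hm : m ∈ B.comp g h) (φ : G → k) :
    contrL B.coactL φ m = φ g • m := by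
  simp [contrL, hm.1]

theorem contrR_comp {g h : G} {m : M} (hm : m ∈ B.comp g h) (φ : G → k) :
    contrR B.coactR φ m = φ h • m := by
  simp [contrR, hm.2]


variable (B) in
theorem coactL_contrL [DecidableEq G] (g : G) (m : M) : B.coactL (contrL B.coactL (Pi.single g 1) m) =
    MonoidAlgebra.single g 1 ⊗ₜ contrL B.coactL (Pi.single g 1) m := by
  have key : ∀ t : MonoidAlgebra k G ⊗[k] M,
      TensorProduct.lid k _ ((linExt (Pi.single g 1)).rTensor _ (TensorProduct.assoc k _ _ _
        ((Coalgebra.comul (R := k)).rTensor M t))) =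
      MonoidAlgebra.single g 1 ⊗ₜ TensorProduct.lid k M
        ((linExt (Pi.single g (1 : k))).rTensor M t) := by
    intro t
    induction t with
    | zero => simp
    | add x y hx hy => simp only [map_add, hx, hy, TensorProduct.tmul_add]
    | tmul x m =>
      induction x using MonoidAlgebra.induction_linear with
      | zero => simp
      | add x y hx hy => simp only [map_add, hx, hy, TensorProduct.tmul_add, TensorProduct.add_tmul]
      | single x a =>
        by_cases h : x = g
        · subst h; simp [TensorProduct.smul_tmul', TensorProduct.tmul_smul]
        · simp [h]
  have nat : ∀ t : MonoidAlgebra k G ⊗[k] M,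
      B.coactL (TensorProduct.lid k M ((linExt (Pi.single g (1 : k))).rTensor M t)) =
      TensorProduct.lid k _ ((linExt (Pi.single g 1)).rTensor _ (B.coactL.lTensor _ t)) := by
    intro t
    induction t with
    | zero => simp
    | add x y hx hy => simp only [map_add, hx, hy]
    | tmul x m => simp
  simp only [contrL, LinearMap.comp_apply, LinearEquiv.coe_coe]
  rw [nat, ← B.coassocL, key]

variable (B) in
theorem coactR_contrR [DecidableEq G] (g : G) (m : M) : B.coactR (contrR B.coactR (Pi.single g 1) m) =
    contrR B.coactR (Pi.single g 1) m ⊗ₜ MonoidAlgebra.single g 1 := by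
  have key : ∀ t : M ⊗[k] MonoidAlgebra k G,
      TensorProduct.rid k _ ((linExt (Pi.single g 1)).lTensor _ ((TensorProduct.assoc k _ _ _).symm
        ((Coalgebra.comul (R := k)).lTensor M t))) =
      TensorProduct.rid k M ((linExt (Pi.single g (1 : k))).lTensor M t) ⊗ₜ
        MonoidAlgebra.single g 1 := by
    intro t
    induction t with
    | zero => simp
    | add x y hx hy => simp only [map_add, hx, hy, TensorProduct.add_tmul]
    | tmul m x =>
      induction x using MonoidAlgebra.induction_linear with
      | zero => simp
      | add x y hx hy => simp only [map_add, hx, hy, TensorProduct.tmul_add, TensorProduct.add_tmul]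
      | single x a =>
        by_cases h : x = g
        · subst h; simp [TensorProduct.smul_tmul']
        · simp [h]
  have nat : ∀ t : M ⊗[k] MonoidAlgebra k G,
      B.coactR (TensorProduct.rid k M ((linExt (Pi.single g (1 : k))).lTensor M t)) =
      TensorProduct.rid k _ ((linExt (Pi.single g 1)).lTensor _ (B.coactR.rTensor _ t)) := by
    intro t
    induction t with
    | zero => simp
    | add x y hx hy => simp only [map_add, hx, hy]
    | tmul x m => simp
  simp only [contrR, LinearMap.comp_apply, LinearEquiv.coe_coe]
  rw [nat, ← key, ← B.coassocR, LinearEquiv.symm_apply_apply]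

variable (B) in
theorem coactR_contrL (φ : G → k) (m : M) : B.coactR (contrL B.coactL φ m) =
    (contrL B.coactL φ).rTensor _ (B.coactR m) := by
  have nat : ∀ t : MonoidAlgebra k G ⊗[k] M,
      B.coactR (TensorProduct.lid k M ((linExt φ).rTensor M t)) =
      TensorProduct.lid k _ ((linExt φ).rTensor _ (B.coactR.lTensor _ t)) := by
    intro t
    induction t with
    | zero => simp
    | add x y hx hy => simp only [map_add, hx, hy]
    | tmul x m => simp
  have key : ∀ t : M ⊗[k] MonoidAlgebra k G,
      TensorProduct.lid k _ ((linExt φ).rTensor _ (TensorProduct.assoc k _ _ _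
        (B.coactL.rTensor _ t))) = (contrL B.coactL φ).rTensor _ t := by
    intro t
    induction t with
    | zero => simp
    | add x y hx hy => simp only [map_add, hx, hy]
    | tmul m x =>
      simp only [LinearMap.rTensor_tmul, contrL, LinearMap.comp_apply, LinearEquiv.coe_coe]
      generalize B.coactL m = s
      induction s with
      | zero => simp
      | add x y hx hy => simp only [map_add, hx, hy, TensorProduct.add_tmul]
      | tmul y m => simp [TensorProduct.smul_tmul']
  rw [← key, B.bicomodule, ← nat]
  simp [contrL]

variable (B) in
/-- `M` is the sum of its isotypic components. -/
theorem iSup_comp : ⨆ p : G × G, B.comp p.1 p.2 = ⊤ := by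
  classical
  have hL : ∀ t : MonoidAlgebra k G ⊗[k] M, TensorProduct.lid k M
      ((Coalgebra.counit (R := k)).rTensor M t) ∈ Submodule.span k
        {x | ∃ g : G, x = TensorProduct.lid k M ((linExt (Pi.single g (1 : k))).rTensor M t)} := by
    intro t
    set f := TensorProduct.finsuppScalarLeft k M G
      ((MonoidAlgebra.coeffLinearEquiv k).toLinearMap.rTensor M t) with hf
    have h1 : TensorProduct.lid k M ((Coalgebra.counit (R := k)).rTensor M t) =
        f.sum fun _ x => x := by
      rw [hf]; clear hf f
      induction t with
      | zero => simp
      | add x y hx hy =>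
        simp only [map_add, hx, hy]
        rw [Finsupp.sum_add_index'] <;> simp
      | tmul x m =>
        induction x using MonoidAlgebra.induction_linear with
        | zero => simp
        | add x y hx hy =>
          simp only [map_add, hx, hy, TensorProduct.add_tmul]
          rw [Finsupp.sum_add_index'] <;> simp
        | single x a => simp [TensorProduct.finsuppScalarLeft_apply_tmul]
    have h2 : ∀ g, f g = TensorProduct.lid k M ((linExt (Pi.single g (1 : k))).rTensor M t) := by
      intro g
      rw [hf]; clear h1 hf f
      induction t with
      | zero => simp
      | add x y hx hy => simp only [map_add, Finsupp.add_apply, hx, hy]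
      | tmul x m =>
        induction x using MonoidAlgebra.induction_linear with
        | zero => simp
        | add x y hx hy => simp only [map_add, Finsupp.add_apply, hx, hy, TensorProduct.add_tmul]
        | single x a =>
          by_cases h : x = g
          · subst h; simp
          · simp [h]
    rw [h1]
    exact Submodule.sum_mem _ fun g _ => Submodule.subset_span ⟨g, h2 g⟩
  have hR : ∀ t : M ⊗[k] MonoidAlgebra k G, TensorProduct.rid k M
      ((Coalgebra.counit (R := k)).lTensor M t) ∈ Submodule.span k
        {x | ∃ g : G, x = TensorProduct.rid k M ((linExt (Pi.single g (1 : k))).lTensor M t)} := by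
    intro t
    have := hL (TensorProduct.comm k _ _ t)
    have e1 : ∀ φ : MonoidAlgebra k G →ₗ[k] k, TensorProduct.lid k M (φ.rTensor M
        (TensorProduct.comm k _ _ t)) = TensorProduct.rid k M (φ.lTensor M t) := by
      intro φ
      induction t with
      | zero => simp
      | add x y hx hy =>
        have hx := hx (hL _)
        have hy := hy (hL _)
        simp only [map_add, hx, hy]
      | tmul x m => simp
    simpa only [e1] using this
  rw [eq_top_iff]
  rintro m -
  have h1 := hR (B.coactR m)
  rw [B.counitR] at h1
  refine Submodule.span_le.2 ?_ h1
  rintro _ ⟨h, rfl⟩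
  have h2 := hL (B.coactL (contrR B.coactR (Pi.single h 1) m))
  rw [B.counitL] at h2
  refine Submodule.span_le.2 ?_ h2
  rintro _ ⟨g, rfl⟩
  refine Submodule.mem_iSup_of_mem (g, h) ⟨B.coactL_contrL g _, ?_⟩
  have := B.coactR_contrL (Pi.single g 1) (contrR B.coactR (Pi.single h 1) m)
  rw [B.coactR_contrR] at this
  exact this

/-- Linear maps which agree on the isotypic components are equal. -/
theorem hom_ext {N : Type*} [AddCommGroup N] [Module k N] {p q : M →ₗ[k] N}
    (H : ∀ g h, ∀ m ∈ B.comp g h, p m = q m) : p = q := by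
  ext m
  have hm : m ∈ ⨆ x : G × G, B.comp x.1 x.2 := by rw [B.iSup_comp]; trivial
  induction hm using Submodule.iSup_induction' with
  | mem i x hx => exact H _ _ x hx
  | zero => simp
  | add x y _ _ hx hy => simp [hx, hy]

variable (B) in
/-- The map `m ↦ F(f, h) / F(f, g) f.m` for `m ∈ ᵍMʰ`. -/
def twistLact (F : GroupGauge k G) (f : G) : M →ₗ[k] M :=
  B.lact f ∘ₗ contrL B.coactL (fun g => ((F f g)⁻¹ : kˣ)) ∘ₗ
    contrR B.coactR (fun h => (F f h : k))

variable (B) in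
/-- The map `m ↦ F(h, f) / F(g, f) m.f` for `m ∈ ᵍMʰ`. -/
def twistRact (F : GroupGauge k G) (f : G) : M →ₗ[k] M :=
  B.ract f ∘ₗ contrL B.coactL (fun g => ((F g f)⁻¹ : kˣ)) ∘ₗ
    contrR B.coactR (fun h => (F h f : k))

theorem twistLact_comp (F : GroupGauge k G) (f : G) {g h : G} {m : M} (hm : m ∈ B.comp g h) :
    B.twistLact F f m = (F f h / F f g : kˣ) • B.lact f m := by
  simp [twistLact, contrR_comp hm, contrL_comp hm, smul_smul, Units.smul_def, div_eq_mul_inv]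

theorem twistRact_comp (F : GroupGauge k G) (f : G) {g h : G} {m : M} (hm : m ∈ B.comp g h) :
    B.twistRact F f m = (F h f / F g f : kˣ) • B.ract f m := by
  simp [twistRact, contrR_comp hm, contrL_comp hm, smul_smul, Units.smul_def, div_eq_mul_inv]

theorem lact_lact_comp (e f : G) {g h : G} {m : M} (hm : m ∈ B.comp g h) :
    B.lact e (B.lact f m) = (Φ e f g / Φ e f h : kˣ) • B.lact (e * f) m := by
  have := B.lact_lact e f m
  rw [contrR_comp hm, contrL_comp hm] at this
  simp only [map_smul] at this
  rw [div_eq_inv_mul, mul_smul, eq_inv_smul_iff]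
  exact this

theorem ract_ract_comp (e f : G) {g h : G} {m : M} (hm : m ∈ B.comp g h) :
    B.ract f (B.ract e m) = (Φ h e f / Φ g e f : kˣ) • B.ract (e * f) m := by
  have := B.ract_ract e f m
  rw [contrR_comp hm, contrL_comp hm] at this
  simp only [map_smul] at this
  rw [div_eq_inv_mul, mul_smul, eq_inv_smul_iff]
  exact this.symm

theorem lact_ract_comp (e f : G) {g h : G} {m : M} (hm : m ∈ B.comp g h) :
    B.ract f (B.lact e m) = (Φ e h f / Φ e g f : kˣ) • B.lact e (B.ract f m) := by
  have := B.lact_ract e f m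
  rw [contrR_comp hm, contrL_comp hm] at this
  simp only [map_smul] at this
  rw [div_eq_inv_mul, mul_smul, eq_inv_smul_iff]
  exact this.symm

variable (B) in
/-- The `(kG, Φ_F)`-Majid bimodule `M_F`: the same bicomodule, with the actions
`f ._F m = F(f, h) / F(f, g) f.m` and `m ._F f = F(h, f) / F(g, f) m.f` for `m ∈ ᵍMʰ`. -/
def twist (F : GroupGauge k G) : MajidBimodule (Φ.twist F) M where
  coactL := B.coactL
  coactR := B.coactR
  coassocL := B.coassocL
  counitL := B.counitL
  coassocR := B.coassocR
  counitR := B.counitR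
  bicomodule := B.bicomodule
  lact := B.twistLact F
  ract := B.twistRact F
  coactL_lact f := by
    refine LinearMap.congr_fun (f := B.coactL ∘ₗ B.twistLact F f)
      (g := TensorProduct.map _ (B.twistLact F f) ∘ₗ B.coactL) (hom_ext (B := B) ?_)
    intro g h m hm
    simp [twistLact_comp F f hm, hm.1, Units.smul_def, (lact_mem hm f).1]
  coactR_lact f := by
    refine LinearMap.congr_fun (f := B.coactR ∘ₗ B.twistLact F f)
      (g := TensorProduct.map (B.twistLact F f) _ ∘ₗ B.coactR) (hom_ext (B := B) ?_)
    intro g h m hm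
    simp [twistLact_comp F f hm, hm.2, Units.smul_def, (lact_mem hm f).2,
      TensorProduct.smul_tmul']
  coactL_ract f := by
    refine LinearMap.congr_fun (f := B.coactL ∘ₗ B.twistRact F f)
      (g := TensorProduct.map _ (B.twistRact F f) ∘ₗ B.coactL) (hom_ext (B := B) ?_)
    intro g h m hm
    simp [twistRact_comp F f hm, hm.1, Units.smul_def, (ract_mem hm f).1]
  coactR_ract f := by
    refine LinearMap.congr_fun (f := B.coactR ∘ₗ B.twistRact F f)
      (g := TensorProduct.map (B.twistRact F f) _ ∘ₗ B.coactR) (hom_ext (B := B) ?_)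
    intro g h m hm
    simp [twistRact_comp F f hm, hm.2, Units.smul_def, (ract_mem hm f).2,
      TensorProduct.smul_tmul']
  one_lact := by
    refine LinearMap.congr_fun (f := B.twistLact F 1) (g := LinearMap.id) (hom_ext (B := B) ?_)
    intro g h m hm
    simp [twistLact_comp F 1 hm, F.one_left, B.one_lact]
  one_ract := by
    refine LinearMap.congr_fun (f := B.twistRact F 1) (g := LinearMap.id) (hom_ext (B := B) ?_)
    intro g h m hm
    simp [twistRact_comp F 1 hm, F.one_right, B.one_ract]
  lact_lact e f := by
    refine LinearMap.congr_fun (f := B.twistLact F e ∘ₗ B.twistLact F f ∘ₗ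
        contrR B.coactR (fun x => (Φ.twist F e f x : k)))
      (g := B.twistLact F (e * f) ∘ₗ contrL B.coactL (fun x => (Φ.twist F e f x : k))) (hom_ext (B := B) ?_)
    intro g h m hm
    simp only [LinearMap.comp_apply, contrR_comp hm, contrL_comp hm, map_smul,
      twistLact_comp F f hm, twistLact_comp F (e * f) hm, Units.smul_def,
      twistLact_comp F e (lact_mem hm f), lact_lact_comp e f hm, smul_smul]
    congr 1
    simp only [ThreeCocycle.twist, differential, Units.val_mul, Units.val_div_eq_div_val]
    field_simp
  ract_ract e f := by
    refine LinearMap.congr_fun (f := B.twistRact F (e * f) ∘ₗ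
        contrR B.coactR (fun x => (Φ.twist F x e f : k)))
      (g := B.twistRact F f ∘ₗ B.twistRact F e ∘ₗ
        contrL B.coactL (fun x => (Φ.twist F x e f : k))) (hom_ext (B := B) ?_)
    intro g h m hm
    simp only [LinearMap.comp_apply, contrR_comp hm, contrL_comp hm, map_smul,
      twistRact_comp F e hm, twistRact_comp F (e * f) hm, Units.smul_def,
      twistRact_comp F f (ract_mem hm e), ract_ract_comp e f hm, smul_smul]
    congr 1
    simp only [ThreeCocycle.twist, differential, Units.val_mul, Units.val_div_eq_div_val]
    field_simp
  lact_ract e f := by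
    refine LinearMap.congr_fun (f := B.twistLact F e ∘ₗ B.twistRact F f ∘ₗ
        contrR B.coactR (fun x => (Φ.twist F e x f : k)))
      (g := B.twistRact F f ∘ₗ B.twistLact F e ∘ₗ
        contrL B.coactL (fun x => (Φ.twist F e x f : k))) (hom_ext (B := B) ?_)
    intro g h m hm
    simp only [LinearMap.comp_apply, contrR_comp hm, contrL_comp hm, map_smul,
      twistRact_comp F f hm, twistLact_comp F e hm, Units.smul_def,
      twistLact_comp F e (ract_mem hm f), twistRact_comp F f (lact_mem hm e),
      lact_ract_comp e f hm, smul_smul]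
    congr 1
    simp only [ThreeCocycle.twist, differential, Units.val_mul, Units.val_div_eq_div_val]
    field_simp

variable {Φ' : ThreeCocycle k G} {N : Type*} [AddCommGroup N] [Module k N]

/-- `M` and `N` are isomorphic Majid bimodules: there is a linear isomorphism compatible with
the coactions and the actions. -/
def IsIsomorphic (B : MajidBimodule Φ M) (B' : MajidBimodule Φ' N) : Prop :=
  ∃ φ : M ≃ₗ[k] N,
    (∀ m, B'.coactL (φ m) = φ.toLinearMap.lTensor _ (B.coactL m)) ∧
    (∀ m, B'.coactR (φ m) = φ.toLinearMap.rTensor _ (B.coactR m)) ∧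
    (∀ g m, B'.lact g (φ m) = φ (B.lact g m)) ∧
    (∀ g m, B'.ract g (φ m) = φ (B.ract g m))

/-- Gauge equivalence of a `(kG, Φ)`-Majid bimodule and a `(kG, Φ')`-Majid bimodule. -/
def GaugeEquivalent (B : MajidBimodule Φ M) (B' : MajidBimodule Φ' N) : Prop :=
  ∃ F : GroupGauge k G, Φ' = Φ.twist F ∧ (B.twist F).IsIsomorphic B'

end MajidBimodule

end Bimodules

/-! ### Collections of projective representations -/

section Collections

variable {k G : Type*} [Field k] [Group G]

/-- An `α`-representation of the group `Z` on `V`: a projective representation with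
`ρ 1 = id` and `ρ e ρ f = α(e, f) ρ (e f)`. (Each `ρ e` is then invertible.) -/
structure ProjRep {Z : Type*} [Group Z] (α : Z → Z → kˣ) (V : Type*) [AddCommGroup V]
    [Module k V] where
  /-- the operators of the representation -/
  ρ : Z → V →ₗ[k] V
  ρ_one : ∀ v, ρ 1 v = v
  ρ_mul : ∀ e f v, ρ e (ρ f v) = (α e f : k) • ρ (e * f) v

/-- Projective equivalence via a given scalar function `μ`: there is a linear isomorphism `φ` with
`ρ₂(g) = μ(g) φ ρ₁(g) φ⁻¹`. -/
def ProjRep.EquivVia {Z : Type*} [Group Z] {α β : Z → Z → kˣ} {V W : Type*}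
    [AddCommGroup V] [Module k V] [AddCommGroup W] [Module k W]
    (μ : Z → kˣ) (R : ProjRep α V) (S : ProjRep β W) : Prop :=
  ∃ φ : V ≃ₗ[k] W, ∀ g w, S.ρ g w = (μ g : k) • φ (R.ρ g (φ.symm w))

/-- Linear equivalence of projective representations. -/
def ProjRep.LinearlyEquivalent {Z : Type*} [Group Z] {α β : Z → Z → kˣ} {V W : Type*}
    [AddCommGroup V] [Module k V] [AddCommGroup W] [Module k W]
    (R : ProjRep α V) (S : ProjRep β W) : Prop :=
  R.EquivVia 1 S

/-- A `Φ`-collection: for each conjugacy class `C` with chosen element `r C`, a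
`Φ̃(-, -, r C)`-representation of the centralizer of `r C`. -/
structure Collection (Φ : ThreeCocycle k G) (r : ConjClasses G → G) (V : ConjClasses G → Type*)
    [∀ C, AddCommGroup (V C)] [∀ C, Module k (V C)] where
  /-- the representation attached to a conjugacy class -/
  rep : ∀ C, ProjRep (Φ.tildeCent (r C)) (V C)

variable {Φ Φ' : ThreeCocycle k G} {r : ConjClasses G → G} {V W : ConjClasses G → Type*}
  [∀ C, AddCommGroup (V C)] [∀ C, Module k (V C)] [∀ C, AddCommGroup (W C)] [∀ C, Module k (W C)]

namespace Collection

/-- The `Φ_F`-collection `(M^F_C)`: the same spaces, with the actions rescaled by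
`F(f, f⁻¹) / (F(f, g(C)) F(f g(C), f⁻¹))`. -/
def twist (X : Collection Φ r V) (F : GroupGauge k G) : Collection (Φ.twist F) r V where
  rep C :=
    { ρ := fun f => (F.mu (r C) f : k) • (X.rep C).ρ f
      ρ_one := fun v => by simp [(X.rep C).ρ_one, F.mu_one]
      ρ_mul := fun e f v => by
        have h := congrArg (fun u : kˣ => (u : k)) (Φ.tildeCent_twist F (r C) e f)
        simp only [Units.val_mul] at h
        simp only [LinearMap.smul_apply, map_smul, (X.rep C).ρ_mul, smul_smul]
        rw [h]
        congr 1
        ring }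

/-- Gauge equivalence of a `Φ`-collection and a `Φ'`-collection. -/
def GaugeEquivalent (X : Collection Φ r V) (Y : Collection Φ' r W) : Prop :=
  ∃ F : GroupGauge k G, Φ' = Φ.twist F ∧
    ∀ C, ((X.twist F).rep C).LinearlyEquivalent (Y.rep C)

/-- Uniform projective equivalence of a `Φ`-collection and a `Φ'`-collection: for some gauge
transformation `F` with `Φ' = Φ ∂F`, the representations attached to each class `C` are
projectively equivalent via the function `μ^F_C` determined by `F`. -/
def UniformlyProjEquivalent (X : Collection Φ r V) (Y : Collection Φ' r W) : Prop :=
  ∃ F : GroupGauge k G, Φ' = Φ.twist F ∧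
    ∀ C, ProjRep.EquivVia (F.mu (r C)) (X.rep C) (Y.rep C)

/-- A family of linear representations of the centralizers, as an admissible collection (for the
trivial 3-cocycle). -/
def ofLinear (σ : ∀ C, Representation k (Cent (r C)) (V C)) :
    Collection (ThreeCocycle.trivial k G) r V where
  rep C :=
    { ρ := σ C
      ρ_one := fun v => by simp
      ρ_mul := fun e f v => by
        simp [ThreeCocycle.tildeCent, ThreeCocycle.tilde, ThreeCocycle.trivial] }

end Collection

/-- The admissible collection `(M_C)` of a Majid bimodule: `M_C` is the isotypic component of
degree `(r C, 1)`, on which `f ∈ Z_C` acts by `f ▷ m = (f.m).f⁻¹`. -/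
def MajidBimodule.collection {M : Type*} [AddCommGroup M] [Module k M] (B : MajidBimodule Φ M)
    (r : ConjClasses G → G) : Collection Φ r (fun C => B.comp (r C) 1) where
  rep C :=
    { ρ := fun f => (B.ract (f : G)⁻¹ ∘ₗ B.lact f).restrict (p := B.comp (r C) 1)
        (q := B.comp (r C) 1) fun m hm => by
          have h := MajidBimodule.ract_mem (MajidBimodule.lact_mem hm (f : G)) (f : G)⁻¹
          have h1 : (f : G) * r C * (f : G)⁻¹ = r C := by
            rw [Subgroup.mem_centralizer_singleton_iff.1 f.2]; group
          simpa [h1] using h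
      ρ_one := fun v => by
        apply Subtype.ext
        simp [B.one_lact, B.one_ract]
      ρ_mul := fun e f v => by
        obtain ⟨v, hv⟩ := v
        apply Subtype.ext
        have h1 := MajidBimodule.lact_mem hv (f : G)
        have h2 := MajidBimodule.lact_ract_comp (e : G) (f : G)⁻¹ h1
        have h3 := MajidBimodule.lact_lact_comp (e : G) (f : G) hv
        have h4 := MajidBimodule.lact_mem hv (e * f : G)
        have h5 := MajidBimodule.ract_ract_comp (f : G)⁻¹ (e : G)⁻¹ h4
        simp only [LinearMap.coe_restrict_apply, LinearMap.comp_apply, SetLike.val_smul,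
          Subgroup.coe_mul, mul_inv_rev]
        have h6 : B.lact (e : G) (B.ract (f : G)⁻¹ (B.lact (f : G) v)) =
            (Φ e (f * r C) (f : G)⁻¹ / Φ e (f * 1) (f : G)⁻¹ : kˣ) •
              B.ract (f : G)⁻¹ (B.lact (e : G) (B.lact (f : G) v)) := by
          rw [h2, smul_smul]; simp
        rw [h6, h3]
        simp only [Units.smul_def, map_smul] at h5 ⊢
        rw [h5, smul_smul, smul_smul]
        congr 1
        simp only [ThreeCocycle.tildeCent, ThreeCocycle.tilde, Units.val_mul,
          Units.val_div_eq_div_val, mul_one, Φ.one_right, Units.val_one]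
        field_simp }

end Collections

/-! ### Majid algebras and gauge equivalence -/

section MajidAlgebras

open TensorProduct WithConv

variable (k : Type*) [Field k]

/-- The operations of a Majid algebra (dual quasi-Hopf algebra) with underlying coalgebra `H`: unit,
multiplication and reassociator. The quasi-antipode is not recorded: it is determined by these
operations up to a convolution invertible functional, and isomorphisms, subobjects and gauge
transformations are formulated in terms of these operations. -/
structure MajidData (H : Type*) [AddCommGroup H] [Module k H] [Coalgebra k H] where
  /-- the unit element -/
  one : H
  /-- the multiplication -/
  mul : H ⊗[k] H →ₗ[k] H
  /-- the reassociator -/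
  assoc : H ⊗[k] (H ⊗[k] H) →ₗ[k] k

variable {k}

namespace MajidData

/-- A Hopf algebra, as a Majid algebra with trivial reassociator `ε ⊗ ε ⊗ ε`. -/
def ofHopfAlgebra (A : Type*) [Ring A] [HopfAlgebra k A] : MajidData k A where
  one := 1
  mul := LinearMap.mul' k A
  assoc := Coalgebra.counit

variable {H : Type*} [AddCommGroup H] [Module k H] [Coalgebra k H] (D : MajidData k H)

/-- A gauge transformation on `H`: a convolution invertible functional `F` on `H ⊗ H` with
`F(h, 1) = F(1, h) = ε(h)`. -/
structure Gauge where
  /-- the functional, as a unit of the convolution algebra -/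
  F : (WithConv (H ⊗[k] H →ₗ[k] k))ˣ
  right_one : ∀ h, F.val (h ⊗ₜ D.one) = Coalgebra.counit (R := k) h
  left_one : ∀ h, F.val (D.one ⊗ₜ h) = Coalgebra.counit (R := k) h

/-- The map `x ↦ φ(x₁) f(x₂) ψ(x₃)`. -/
def convSandwich {C N : Type*} [AddCommGroup C] [Module k C] [Coalgebra k C] [AddCommGroup N]
    [Module k N] (φ : C →ₗ[k] k) (f : C →ₗ[k] N) (ψ : C →ₗ[k] k) : C →ₗ[k] N :=
  (TensorProduct.lid k N).toLinearMap ∘ₗ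
    TensorProduct.map φ ((TensorProduct.rid k N).toLinearMap ∘ₗ TensorProduct.map f ψ ∘ₗ
      Coalgebra.comul) ∘ₗ Coalgebra.comul

variable {D}

/-- The Majid algebra `H_F`, with product `g ·_F h = F⁻¹(g₁, h₁) g₂h₂ F(g₃, h₃)` and reassociator
`Φ_F(f, g, h) = F⁻¹(g₁, h₁) F⁻¹(f₁, g₂h₂) Φ(f₂, g₃, h₃) F(f₃g₄, h₄) F(f₄, g₅)`; the latter is a
convolution product of five functionals on `H ⊗ H ⊗ H`. -/
def twist (γ : D.Gauge) : MajidData k H where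
  one := D.one
  mul := convSandwich (γ.F⁻¹).val.ofConv D.mul γ.F.val.ofConv
  assoc := ofConv <|
    toConv (LinearMap.mul' k k ∘ₗ TensorProduct.map Coalgebra.counit (γ.F⁻¹).val.ofConv) *
    toConv ((γ.F⁻¹).val.ofConv ∘ₗ D.mul.lTensor H) *
    toConv D.assoc *
    toConv (γ.F.val.ofConv ∘ₗ D.mul.rTensor H ∘ₗ (TensorProduct.assoc k H H H).symm.toLinearMap) *
    toConv (LinearMap.mul' k k ∘ₗ TensorProduct.map γ.F.val.ofConv Coalgebra.counit ∘ₗ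
      (TensorProduct.assoc k H H H).symm.toLinearMap)

variable (D)

/-- `D` and `E` are isomorphic: there is a coalgebra isomorphism preserving the unit, the product
and the reassociator. -/
def IsIsomorphic {A : Type*} [AddCommGroup A] [Module k A] [Coalgebra k A]
    (E : MajidData k A) : Prop :=
  ∃ φ : H ≃ₗc[k] A, φ D.one = E.one ∧ (∀ x y, φ (D.mul (x ⊗ₜ y)) = E.mul (φ x ⊗ₜ φ y)) ∧
    ∀ x y z, E.assoc (φ x ⊗ₜ (φ y ⊗ₜ φ z)) = D.assoc (x ⊗ₜ (y ⊗ₜ z))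

/-- Gauge equivalence of Majid algebras. -/
def GaugeEquivalent {A : Type*} [AddCommGroup A] [Module k A] [Coalgebra k A]
    (E : MajidData k A) : Prop :=
  ∃ γ : D.Gauge, (twist γ).IsIsomorphic E

/-- A subspace is a sub Majid algebra if it is a subcoalgebra which contains the unit and is closed
under multiplication. -/
structure IsSub (W : Submodule k H) : Prop where
  comul_mem : ∀ x ∈ W, Coalgebra.comul (R := k) x ∈
    LinearMap.range (TensorProduct.map W.subtype W.subtype)
  one_mem : D.one ∈ W
  mul_mem : ∀ x ∈ W, ∀ y ∈ W, D.mul (x ⊗ₜ y) ∈ W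

/-- The smallest sub Majid algebra containing a given set. -/
def adjoin (S : Set H) : Submodule k H := sInf {W | D.IsSub W ∧ S ⊆ W}

theorem mem_range_map_sInf {H : Type*} [AddCommGroup H] [Module k H] (𝒲 : Set (Submodule k H))
    (t : H ⊗[k] H)
    (ht : ∀ W ∈ 𝒲, t ∈ LinearMap.range (TensorProduct.map W.subtype W.subtype)) :
    t ∈ LinearMap.range (TensorProduct.map (sInf 𝒲).subtype (sInf 𝒲).subtype) := by
  classical
  set V := sInf 𝒲 with hV
  obtain ⟨p, hp⟩ := V.subtype.exists_leftInverse_of_injective V.ker_subtype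
  set P : H →ₗ[k] H := V.subtype ∘ₗ p with hP
  have hPV : ∀ v ∈ V, P v = v := fun v hv => by
    have := LinearMap.congr_fun hp ⟨v, hv⟩
    simpa [hP] using congrArg Subtype.val this
  -- contractions of `t` with functionals lie in `V`
  have hl : ∀ φ : H →ₗ[k] k, TensorProduct.lid k H (φ.rTensor H t) ∈ V := by
    intro φ
    rw [hV, Submodule.mem_sInf]
    intro W hW
    obtain ⟨s, hs⟩ := ht W hW
    rw [← hs]
    clear hs
    induction s with
    | zero => simp
    | add x y hx hy => simpa only [map_add] using W.add_mem hx hy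
    | tmul x y => simpa using W.smul_mem _ y.2
  have hr : ∀ φ : H →ₗ[k] k, TensorProduct.rid k H (φ.lTensor H t) ∈ V := by
    intro φ
    rw [hV, Submodule.mem_sInf]
    intro W hW
    obtain ⟨s, hs⟩ := ht W hW
    rw [← hs]
    clear hs
    induction s with
    | zero => simp
    | add x y hx hy => simpa only [map_add] using W.add_mem hx hy
    | tmul x y => simpa using W.smul_mem _ x.2
  have b := Module.Basis.ofVectorSpace k H
  have el : P.lTensor H t = t := by
    apply (TensorProduct.equivFinsuppOfBasisLeft b).injective
    ext i
    have key : ∀ u : H ⊗[k] H, TensorProduct.equivFinsuppOfBasisLeft b u i =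
        TensorProduct.lid k H ((b.coord i).rTensor H u) := by
      intro u
      induction u with
      | zero => simp
      | add x y hx hy => simp only [map_add, Finsupp.add_apply, hx, hy]
      | tmul x y => simp
    rw [key, key]
    have : TensorProduct.lid k H ((b.coord i).rTensor H (P.lTensor H t)) =
        P (TensorProduct.lid k H ((b.coord i).rTensor H t)) := by
      clear ht hl hr
      induction t with
      | zero => simp
      | add x y hx hy => simp only [map_add, hx, hy]
      | tmul x y => simp
    rw [this, hPV _ (hl _)]
  have er : P.rTensor H t = t := by
    apply (TensorProduct.equivFinsuppOfBasisRight b).injective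
    ext i
    have key : ∀ u : H ⊗[k] H, TensorProduct.equivFinsuppOfBasisRight b u i =
        TensorProduct.rid k H ((b.coord i).lTensor H u) := by
      intro u
      induction u with
      | zero => simp
      | add x y hx hy => simp only [map_add, Finsupp.add_apply, hx, hy]
      | tmul x y => simp
    rw [key, key]
    have : TensorProduct.rid k H ((b.coord i).lTensor H (P.rTensor H t)) =
        P (TensorProduct.rid k H ((b.coord i).lTensor H t)) := by
      clear ht hl hr el
      induction t with
      | zero => simp
      | add x y hx hy => simp only [map_add, hx, hy]
      | tmul x y => simp
    rw [this, hPV _ (hr _)]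
  refine ⟨TensorProduct.map p p t, ?_⟩
  rw [← LinearMap.comp_apply, ← TensorProduct.map_comp]
  change TensorProduct.map P P t = t
  have : TensorProduct.map P P = P.rTensor H ∘ₗ P.lTensor H := by
    simp [LinearMap.rTensor, LinearMap.lTensor, ← TensorProduct.map_comp]
  rw [this, LinearMap.comp_apply, el, er]

theorem isSub_adjoin (S : Set H) : D.IsSub (D.adjoin S) where
  comul_mem x hx := mem_range_map_sInf _ _ fun W hW =>
    hW.1.comul_mem x (Submodule.mem_sInf.1 hx W hW)
  one_mem := Submodule.mem_sInf.2 fun _ hW => hW.1.one_mem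
  mul_mem x hx y hy := Submodule.mem_sInf.2 fun W hW =>
    hW.1.mul_mem x (Submodule.mem_sInf.1 hx W hW) y (Submodule.mem_sInf.1 hy W hW)

theorem subset_adjoin (S : Set H) : S ⊆ D.adjoin S := fun _ hx =>
  Submodule.mem_sInf.2 fun _ hW => hW.2 hx

end MajidData

section Subcoalgebra

variable {H : Type*} [AddCommGroup H] [Module k H]

theorem map_subtype_injective (W : Submodule k H) :
    Function.Injective (TensorProduct.map W.subtype W.subtype) :=
  TensorProduct.map_injective_of_flat_flat _ _ W.injective_subtype W.injective_subtype

variable [Coalgebra k H] {W : Submodule k H}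

/-- The comultiplication of a subcoalgebra. -/
def subComul (hW : ∀ x ∈ W, Coalgebra.comul (R := k) x ∈
    LinearMap.range (TensorProduct.map W.subtype W.subtype)) : W →ₗ[k] W ⊗[k] W :=
  (LinearEquiv.ofInjective _ (map_subtype_injective W)).symm.toLinearMap ∘ₗ
    (Coalgebra.comul (R := k) ∘ₗ W.subtype).codRestrict _ fun x => hW x x.2

theorem map_subComul (hW : ∀ x ∈ W, Coalgebra.comul (R := k) x ∈
    LinearMap.range (TensorProduct.map W.subtype W.subtype)) (x : W) :
    TensorProduct.map W.subtype W.subtype (subComul hW x) = Coalgebra.comul (R := k) (x : H) :=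
  congrArg Subtype.val (LinearEquiv.apply_symm_apply
    (LinearEquiv.ofInjective _ (map_subtype_injective W)) ⟨_, hW x x.2⟩)

/-- The coalgebra structure of a subcoalgebra. -/
@[reducible]
def subCoalgebra (hW : ∀ x ∈ W, Coalgebra.comul (R := k) x ∈
    LinearMap.range (TensorProduct.map W.subtype W.subtype)) : Coalgebra k W where
  comul := subComul hW
  counit := Coalgebra.counit (R := k) ∘ₗ W.subtype
  coassoc := by
    have inj : Function.Injective (TensorProduct.map W.subtype
        (TensorProduct.map W.subtype W.subtype)) :=
      TensorProduct.map_injective_of_flat_flat _ _ W.injective_subtype (map_subtype_injective W)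
    have n1 : ∀ t : W ⊗[k] W, TensorProduct.map W.subtype (TensorProduct.map W.subtype W.subtype)
        (TensorProduct.assoc k W W W ((subComul hW).rTensor W t)) =
        TensorProduct.assoc k H H H ((Coalgebra.comul (R := k)).rTensor H
          (TensorProduct.map W.subtype W.subtype t)) := by
      intro t
      induction t with
      | zero => simp
      | add x y hx hy => simp only [map_add, hx, hy]
      | tmul x y =>
        simp only [LinearMap.rTensor_tmul, TensorProduct.map_tmul, Submodule.subtype_apply]
        rw [← map_subComul hW x]
        generalize subComul hW x = u
        induction u with
        | zero => simp
        | add a b ha hb => simp only [map_add, TensorProduct.add_tmul, ha, hb]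
        | tmul a b => simp
    have n2 : ∀ t : W ⊗[k] W, TensorProduct.map W.subtype (TensorProduct.map W.subtype W.subtype)
        ((subComul hW).lTensor W t) =
        (Coalgebra.comul (R := k)).lTensor H (TensorProduct.map W.subtype W.subtype t) := by
      intro t
      induction t with
      | zero => simp
      | add x y hx hy => simp only [map_add, hx, hy]
      | tmul x y => simp [map_subComul]
    ext1 x
    apply inj
    simp only [LinearMap.comp_apply, LinearEquiv.coe_coe]
    rw [n1, n2, map_subComul]
    simp
  rTensor_counit_comp_comul := by
    have n : ∀ t : W ⊗[k] W, W.subtype.lTensor k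
        ((Coalgebra.counit (R := k) ∘ₗ W.subtype).rTensor W t) =
        (Coalgebra.counit (R := k)).rTensor H (TensorProduct.map W.subtype W.subtype t) := by
      intro t
      induction t with
      | zero => simp
      | add x y hx hy => simp only [map_add, hx, hy]
      | tmul x y => simp
    ext1 x
    apply Module.Flat.lTensor_preserves_injective_linearMap (M := k) _ W.injective_subtype
    simp only [LinearMap.comp_apply]
    rw [n, map_subComul]
    simp
  lTensor_counit_comp_comul := by
    have n : ∀ t : W ⊗[k] W, W.subtype.rTensor k
        ((Coalgebra.counit (R := k) ∘ₗ W.subtype).lTensor W t) =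
        (Coalgebra.counit (R := k)).lTensor H (TensorProduct.map W.subtype W.subtype t) := by
      intro t
      induction t with
      | zero => simp
      | add x y hx hy => simp only [map_add, hx, hy]
      | tmul x y => simp
    ext1 x
    apply Module.Flat.rTensor_preserves_injective_linearMap (M := k) _ W.injective_subtype
    simp only [LinearMap.comp_apply]
    rw [n, map_subComul]
    simp

end Subcoalgebra

namespace MajidData

variable {H : Type*} [AddCommGroup H] [Module k H] [Coalgebra k H] (D : MajidData k H)

instance (S : Set H) : Coalgebra k (D.adjoin S) := subCoalgebra (D.isSub_adjoin S).comul_mem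

/-- The sub Majid algebra generated by a set, with the restricted operations. -/
def generated (S : Set H) : MajidData k (D.adjoin S) where
  one := ⟨D.one, (D.isSub_adjoin S).one_mem⟩
  mul := (D.mul ∘ₗ TensorProduct.map (D.adjoin S).subtype (D.adjoin S).subtype).codRestrict _ <| by
    intro t
    induction t with
    | zero => simp
    | add x y hx hy => simpa only [map_add] using Submodule.add_mem _ hx hy
    | tmul x y => exact (D.isSub_adjoin S).mul_mem x x.2 y y.2
  assoc := D.assoc ∘ₗ TensorProduct.map (D.adjoin S).subtype
    (TensorProduct.map (D.adjoin S).subtype (D.adjoin S).subtype)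

end MajidData

/-- `H` is gauge equivalent to a Hopf algebra. -/
def MajidData.GaugeEquivalentToHopf {H : Type u} [AddCommGroup H] [Module k H] [Coalgebra k H]
    (D : MajidData k H) : Prop :=
  ∃ (A : Type u) (_ : Ring A) (_ : HopfAlgebra k A),
    D.GaugeEquivalent (MajidData.ofHopfAlgebra (k := k) A)

end MajidAlgebras

/-! ### The path coalgebra and the Majid algebras `H(M)` and `B(M)` -/

section Paths

variable {G : Type*}

/-- Paths from `x` in the quiver with vertex set `G` whose arrows from `y` to `z` are indexed by
`ι z y` (target first). -/
inductive APath (ι : G → G → Type*) (x : G) : G → Type _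
  /-- the trivial path at `x` -/
  | triv : APath ι x x
  /-- the path with one more arrow appended at its end -/
  | snoc {y z : G} (p : APath ι x y) (e : ι z y) : APath ι x z

/-- The number of arrows of a path. -/
def APath.len {ι : G → G → Type*} {x : G} : ∀ {y : G}, APath ι x y → ℕ
  | _, .triv => 0
  | _, .snoc p _ => p.len + 1

/-- All ways of writing a path `p` from `x` to `z` as `p = βα` with `α` a path from `x` to some
vertex `y` and `β` a path from `y` to `z`. -/
def APath.splits {ι : G → G → Type*} {x : G} :
    ∀ {z : G}, APath ι x z → List (Σ y : G, APath ι y z × APath ι x y)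
  | _, .triv => [⟨x, .triv, .triv⟩]
  | z, .snoc p e => ⟨z, .triv, .snoc p e⟩ ::
      p.splits.map fun s => ⟨s.1, .snoc s.2.1 e, s.2.2⟩

/-- All paths of the quiver. -/
abbrev AllPaths (ι : G → G → Type*) := Σ (x y : G), APath ι x y

variable (k : Type*) [Field k] (ι : G → G → Type*)

/-- The path coalgebra `kQ`: the vector space with basis the paths. -/
def PathCoalgebra := AllPaths ι →₀ k

instance : AddCommGroup (PathCoalgebra k ι) := inferInstanceAs (AddCommGroup (AllPaths ι →₀ k))

instance : Module k (PathCoalgebra k ι) := inferInstanceAs (Module k (AllPaths ι →₀ k))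

namespace PathCoalgebra

/-- The basis of paths. -/
def basis : Module.Basis (AllPaths ι) k (PathCoalgebra k ι) :=
  .ofRepr (LinearEquiv.refl k (AllPaths ι →₀ k))

variable {ι}

/-- A path, as an element of the path coalgebra. -/
def of {x y : G} (p : APath ι x y) : PathCoalgebra k ι := basis k ι ⟨x, y, p⟩

theorem basis_eq (s : AllPaths ι) : basis k ι s = of k s.2.2 := rfl

/-- The comultiplication `p ↦ ∑ β ⊗ α` over all `p = βα`. -/
def comulMap : PathCoalgebra k ι →ₗ[k] PathCoalgebra k ι ⊗[k] PathCoalgebra k ι :=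
  (basis k ι).constr k fun s => (s.2.2.splits.map fun t => of k t.2.1 ⊗ₜ of k t.2.2).sum

/-- The counit: `1` on vertices and `0` on paths of positive length. -/
def counitMap : PathCoalgebra k ι →ₗ[k] k :=
  (basis k ι).constr k fun s => if s.2.2.len = 0 then 1 else 0

theorem comulMap_of {x y : G} (p : APath ι x y) :
    comulMap k (of k p) = (p.splits.map fun t => of k t.2.1 ⊗ₜ of k t.2.2).sum := by
  simp [comulMap, of]

theorem counitMap_of {x y : G} (p : APath ι x y) :
    counitMap k (of k p) = if p.len = 0 then 1 else 0 := by
  simp [counitMap, of]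

theorem sum_splits {A : Type*} [AddCommMonoid A] {x z : G} (p : APath ι x z)
    (f : ∀ y w : G, APath ι y z → APath ι w y → APath ι x w → A) :
    (p.splits.map fun s => (s.2.1.splits.map fun t => f t.1 s.1 t.2.1 t.2.2 s.2.2).sum).sum =
    (p.splits.map fun s => (s.2.2.splits.map fun t => f s.1 t.1 s.2.1 t.2.1 t.2.2).sum).sum := by
  induction p with
  | triv => simp [APath.splits]
  | snoc p e ih =>
    have := ih (fun y w β γ α => f y w (APath.snoc β e) γ α)
    simp only [APath.splits, List.map_cons, List.map_map, List.sum_cons, Function.comp_def,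
      List.map_nil, List.sum_nil, add_zero, List.sum_map_add] at this ⊢
    rw [this, add_assoc]

theorem sum_splits_len {A : Type*} [AddCommMonoid A] {x z : G} (p : APath ι x z)
    (f : ∀ y : G, APath ι y z → APath ι x y → A) :
    (p.splits.map fun t => if t.2.2.len = 0 then f t.1 t.2.1 t.2.2 else 0).sum = f x p .triv := by
  induction p with
  | triv => simp [APath.splits, APath.len]
  | snoc p e ih =>
    have := ih (fun y β α => f y (.snoc β e) α)
    simpa [APath.splits, APath.len, Function.comp_def] using this

theorem list_sum_tmul {V W : Type*} [AddCommGroup V] [Module k V] [AddCommGroup W] [Module k W]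
    (l : List V) (w : W) : l.sum ⊗ₜ[k] w = (l.map fun v => v ⊗ₜ[k] w).sum :=
  map_list_sum ((TensorProduct.mk k V W).flip w) l

theorem tmul_list_sum {V W : Type*} [AddCommGroup V] [Module k V] [AddCommGroup W] [Module k W]
    (v : V) (l : List W) : v ⊗ₜ[k] l.sum = (l.map fun w => v ⊗ₜ[k] w).sum :=
  map_list_sum (TensorProduct.mk k V W v) l

instance : Coalgebra k (PathCoalgebra k ι) where
  comul := comulMap k
  counit := counitMap k
  coassoc := by
    refine (basis k ι).ext fun s => ?_
    obtain ⟨x, y, p⟩ := s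
    have := sum_splits p (fun _ _ β γ α => of k β ⊗ₜ[k] (of k γ ⊗ₜ[k] of k α))
    simp only [basis_eq, LinearMap.comp_apply, LinearEquiv.coe_coe, comulMap_of, map_list_sum,
      List.map_map, Function.comp_def, LinearMap.rTensor_tmul, LinearMap.lTensor_tmul,
      list_sum_tmul, tmul_list_sum,
      TensorProduct.assoc_tmul]
    exact this
  rTensor_counit_comp_comul := by
    refine (basis k ι).ext fun s => ?_
    obtain ⟨x, y, p⟩ := s
    simp only [basis_eq, LinearMap.comp_apply, comulMap_of, map_list_sum,
      List.map_map, Function.comp_def, LinearMap.rTensor_tmul, counitMap_of]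
    cases p with
    | triv => simp [APath.splits, APath.len]
    | snoc p e => simp [APath.splits, APath.len, Function.comp_def]
  lTensor_counit_comp_comul := by
    refine (basis k ι).ext fun s => ?_
    obtain ⟨x, y, p⟩ := s
    simp only [basis_eq, LinearMap.comp_apply, comulMap_of, map_list_sum,
      List.map_map, Function.comp_def, LinearMap.lTensor_tmul, counitMap_of]
    have := sum_splits_len p (fun _ β α => of k β ⊗ₜ[k] (1 : k))
    rw [LinearMap.flip_apply, TensorProduct.mk_apply, ← this]
    refine congrArg List.sum (List.map_congr_left fun t _ => ?_)
    split_ifs <;> simp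

theorem comul_of {x y : G} (p : APath ι x y) : Coalgebra.comul (R := k) (of k p) =
    (p.splits.map fun t => of k t.2.1 ⊗ₜ[k] of k t.2.2).sum := comulMap_of k p

theorem counit_of {x y : G} (p : APath ι x y) :
    Coalgebra.counit (R := k) (of k p) = if p.len = 0 then 1 else 0 := counitMap_of k p

end PathCoalgebra

end Paths

section PathMajid

variable {k G : Type*} [Field k] [Group G] {Φ : ThreeCocycle k G} {M : Type*} [AddCommGroup M]
  [Module k M]

namespace MajidBimodule

variable (B : MajidBimodule Φ M) {ι : G → G → Type*}
  (b : ∀ g h, Module.Basis (ι g h) k (B.comp g h))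

/-- The coefficients of `g.e`, for an arrow `e` from `y` to `z`, as a combination of arrows. -/
def arrowL (g : G) {z y : G} (e : ι z y) : ι (g * z) (g * y) →₀ k :=
  (b (g * z) (g * y)).repr ⟨B.lact g (b z y e), lact_mem (b z y e).2 g⟩

/-- The coefficients of `e.g`, for an arrow `e` from `y` to `z`, as a combination of arrows. -/
def arrowR (g : G) {z y : G} (e : ι z y) : ι (z * g) (y * g) →₀ k :=
  (b (z * g) (y * g)).repr ⟨B.ract g (b z y e), ract_mem (b z y e).2 g⟩

/-- Append a linear combination of arrows to a linear combination of paths, bilinearly. -/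
def snocLin {x y z : G} (u : APath ι x y →₀ k) (v : ι z y →₀ k) : APath ι x z →₀ k :=
  u.sum fun p s => v.sum fun e t => Finsupp.single (.snoc p e) (s * t)

/-- The product of two paths `p = aₘ⋯a₁` and `q = bₙ⋯b₁`: the sum, over all ways of interleaving
them to thin splits `(p₁, …, pₘ₊ₙ)` of `p` and `(q₁, …, qₘ₊ₙ)` of `q` such that at each position one
entry is an arrow and the other one is a vertex, of the concatenations
`[pₘ₊ₙ.qₘ₊ₙ]⋯[p₁.q₁]`. The recursion is on the last factor, which is either `aₘ.t(q)` or
`t(p).bₙ`, where `t` denotes the end point of a path. -/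
def pathMul : ∀ {x y z w : G}, APath ι x y → APath ι z w → (APath ι (x * z) (y * w) →₀ k)
  | _, _, _, _, .triv, .triv => Finsupp.single .triv 1
  | _, _, _, w, .snoc p e, .triv => snocLin (pathMul p .triv) (B.arrowR b w e)
  | _, y, _, _, .triv, .snoc q e => snocLin (pathMul .triv q) (B.arrowL b y e)
  | _, y, _, w, .snoc p e, .snoc q e' =>
      snocLin (pathMul p (.snoc q e')) (B.arrowR b w e) +
      snocLin (pathMul (.snoc p e) q) (B.arrowL b y e')
termination_by _ _ _ _ p q => p.len + q.len
decreasing_by all_goals simp [APath.len]; try omega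

/-- The multiplication of the path coalgebra. -/
def pathMulMap : PathCoalgebra k ι ⊗[k] PathCoalgebra k ι →ₗ[k] PathCoalgebra k ι :=
  TensorProduct.lift <| (PathCoalgebra.basis k ι).constr k fun s =>
    (PathCoalgebra.basis k ι).constr k fun t =>
      (B.pathMul b s.2.2 t.2.2).sum fun p c => c • PathCoalgebra.of k p

variable (ι Φ) in
/-- The reassociator of `H(M)`: it is `Φ` on vertices, and zero if one of the arguments is a path of
positive length. -/
def pathAssoc :
    PathCoalgebra k ι ⊗[k] (PathCoalgebra k ι ⊗[k] PathCoalgebra k ι) →ₗ[k] k :=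
  TensorProduct.lift <| (PathCoalgebra.basis k ι).constr k fun s =>
    TensorProduct.lift <| (PathCoalgebra.basis k ι).constr k fun t =>
      (PathCoalgebra.basis k ι).constr k fun u =>
        if s.2.2.len = 0 ∧ t.2.2.len = 0 ∧ u.2.2.len = 0 then (Φ s.1 t.1 u.1 : k) else 0

/-- The graded Majid algebra `H(M)` on the path coalgebra of the Hopf quiver of `M`: the vertices
are the elements of `G`, and the arrows from `h` to `g` form a basis of `ᵍMʰ`. -/
def pathMajid : MajidData k (PathCoalgebra k ι) where
  one := PathCoalgebra.of k (.triv : APath ι (1 : G) 1)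
  mul := B.pathMulMap b
  assoc := pathAssoc Φ ι

variable (k ι) in
/-- The vertices and arrows, as elements of the path coalgebra. -/
def lowDegree : Set (PathCoalgebra k ι) :=
  {v | ∃ (x y : G) (p : APath ι x y), p.len ≤ 1 ∧ v = PathCoalgebra.of k p}

/-- The sub Majid algebra `B(M)` of `H(M)` generated in degrees 0 and 1. -/
def nicholsMajid : MajidData k ((B.pathMajid b).adjoin (lowDegree k ι)) :=
  (B.pathMajid b).generated (lowDegree k ι)

end MajidBimodule

end PathMajid

end QuasiQuantum

/-! All six conditions reduce to one: some normalized `F` on `G` makes `Φ_F` trivial. For the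
bimodule and for the two kinds of collections this is almost formal. The equation `Φ' = Φ_F` is part
of each equivalence, and conversely twisting by `F` produces the required object over the trivial
cocycle. For 3-coboundaries one normalizes the cochain and inverts it
(`ThreeCocycle.isCoboundary_iff`).

The content lies in `H(M)` and `B(M)`, treated together as subobjects `W` of `H(M)` containing the
vertices. The degree zero projection `kQ → kG` and the embedding of `kG` in `W` by vertices are
morphisms of Majid algebras, where `kG` carries the reassociator `Φ`. Gauge transformations pull
back along morphisms, and twisting commutes with this pullback (`MajidData.IsHom.twist`).

If `W` is gauge equivalent to a Hopf algebra, the gauge transformation is restricted to the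
vertices. The twisted reassociator is trivial, and on group elements it is `Φ_F` for the restricted
`F` (`exists_twist_eq_one`).

Conversely, let `Φ_F` be trivial and pull `F` back to `kQ`. A functional that factors through degree
zero sees only the end points of paths, so twisting rescales the product of two paths by a scalar.
The scalars telescope along the paths, which gives `H(M)_F = H(M_F)` (`twist_pathGauge`). As `M_F`
is a Hopf bimodule, `H(M_F)` is a bialgebra: associativity and multiplicativity of the
comultiplication follow by induction on length, by comparing the last arrows of products
(`pmul_assoc_path`, `comul_pmul_path`). Bialgebra axioms descend to `W`. An antipode exists because
the vertices are invertible and a map with invertible values at the vertices is convolution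
invertible: up to its degree zero part it is `1 - n` with `n` locally nilpotent for the length
filtration (`isUnit_of_isUnit_at_vertices`). -/

namespace QuasiQuantum

open WithConv Coalgebra

/-! ### Morphisms of Majid algebras and pullbacks of gauge transformations -/

section Hom

variable {k : Type*} [Field k] {C H A : Type*} [AddCommGroup C] [Module k C] [Coalgebra k C]
  [AddCommGroup H] [Module k H] [Coalgebra k H] [Ring A] [Algebra k A]

/-- Composition with a coalgebra morphism, as a morphism of convolution algebras. -/
def convComap (f : C →ₗc[k] H) : WithConv (H →ₗ[k] A) →+* WithConv (C →ₗ[k] A) where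
  toFun φ := toConv (φ.ofConv ∘ₗ f.toLinearMap)
  map_one' := by ext x; simp [LinearMap.convOne_def]
  map_mul' φ ψ := by
    rw [LinearMap.convMul_comp_coalgHom_distrib]
  map_zero' := rfl
  map_add' _ _ := rfl

@[simp] theorem convComap_apply (f : C →ₗc[k] H) (φ : WithConv (H →ₗ[k] A)) (x : C) :
    convComap f φ x = φ (f x) := rfl

/-- This turns the convolution formulas for twists into pointwise formulas on group elements and
vertices. -/
theorem convMul_apply_of_isGroupLikeElem {c : C} (hc : IsGroupLikeElem k c)
    (φ ψ : WithConv (C →ₗ[k] A)) : (φ * ψ) c = φ c * ψ c := by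
  simp [hc.comul_eq_tmul_self]

theorem IsGroupLikeElem.tmul {c : C} {h : H} (hc : IsGroupLikeElem k c)
    (hh : IsGroupLikeElem k h) : IsGroupLikeElem k (c ⊗ₜ[k] h) where
  counit_eq_one := by simp [hc.counit_eq_one, hh.counit_eq_one]
  comul_eq_tmul_self := by simp [hc.comul_eq_tmul_self, hh.comul_eq_tmul_self]

namespace MajidData

variable {N P : Type*} [AddCommGroup N] [Module k N] [AddCommGroup P] [Module k P]

/-- The outer factors are scalars, so they pass through any linear map. Together with naturality in
the source, this makes twisted products compatible with morphisms. -/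
theorem comp_convSandwich (g : N →ₗ[k] P) (φ : H →ₗ[k] k) (f : H →ₗ[k] N) (ψ : H →ₗ[k] k) (x : H) :
    g (convSandwich φ f ψ x) = convSandwich φ (g ∘ₗ f) ψ x := by
  simp only [convSandwich, LinearMap.comp_apply, LinearEquiv.coe_coe]
  induction comul (R := k) x with
  | zero => simp
  | add a b ha hb => simp only [map_add, ha, hb]
  | tmul a b =>
    simp only [TensorProduct.map_tmul, LinearMap.comp_apply, LinearEquiv.coe_coe,
      TensorProduct.lid_tmul, map_smul]
    congr 1
    induction comul (R := k) b with
    | zero => simp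
    | add a b ha hb => simp only [map_add, ha, hb]
    | tmul a b => simp

/-- A coalgebra morphism commutes with both of the comultiplications that produce `x₁ ⊗ x₂ ⊗ x₃`. -/
theorem convSandwich_comp (h : C →ₗc[k] H) (φ : H →ₗ[k] k) (f : H →ₗ[k] N) (ψ : H →ₗ[k] k)
    (x : C) : convSandwich φ f ψ (h x) =
      convSandwich (φ ∘ₗ h.toLinearMap) (f ∘ₗ h.toLinearMap) (ψ ∘ₗ h.toLinearMap) x := by
  simp only [convSandwich, LinearMap.comp_apply, LinearEquiv.coe_coe]
  rw [← CoalgHomClass.map_comp_comul_apply]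
  induction comul (R := k) x with
  | zero => simp
  | add a b ha hb => simp only [map_add, ha, hb]
  | tmul a b =>
    simp only [TensorProduct.map_tmul, LinearMap.comp_apply, LinearEquiv.coe_coe,
      TensorProduct.lid_tmul]
    congr 1
    have := CoalgHomClass.map_comp_comul_apply h b
    simp only [LinearMap.coe_coe] at this ⊢
    rw [← this]
    induction comul (R := k) b with
    | zero => simp
    | add a b ha hb => simp only [map_add, ha, hb]
    | tmul a b => simp

/-- A coalgebra morphism preserving the unit, the product and the reassociator. -/
structure IsHom (D : MajidData k C) (E : MajidData k H) (f : C →ₗc[k] H) : Prop where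
  map_one : f D.one = E.one
  map_mul : ∀ x y, f (D.mul (x ⊗ₜ y)) = E.mul (f x ⊗ₜ f y)
  map_assoc : ∀ x y z, D.assoc (x ⊗ₜ (y ⊗ₜ z)) = E.assoc (f x ⊗ₜ (f y ⊗ₜ f z))

variable {D : MajidData k C} {E : MajidData k H} {f : C →ₗc[k] H}

/-- The pullback of a gauge transformation along a morphism. -/
def Gauge.comap (hf : IsHom D E f) (γ : E.Gauge) : D.Gauge where
  F := Units.map (convComap (Coalgebra.TensorProduct.map f f)).toMonoidHom γ.F
  right_one h := by
    change γ.F.val (f h ⊗ₜ f D.one) = _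
    rw [hf.map_one, γ.right_one]; simp
  left_one h := by
    change γ.F.val (f D.one ⊗ₜ f h) = _
    rw [hf.map_one, γ.left_one]; simp

/-- Twisting is built from convolution and the operations. Pullback along a coalgebra morphism is a
ring homomorphism of convolution algebras, hence respects products and inverses. -/
theorem IsHom.twist (hf : IsHom D E f) (γ : E.Gauge) :
    IsHom (MajidData.twist (γ.comap hf)) (MajidData.twist γ) f where
  map_one := hf.map_one
  map_mul x y := by
    have e : f.toLinearMap ∘ₗ D.mul = E.mul ∘ₗ (Coalgebra.TensorProduct.map f f).toLinearMap :=
      TensorProduct.ext' hf.map_mul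
    have h1 := comp_convSandwich f.toLinearMap ((γ.comap hf).F⁻¹).val.ofConv D.mul
      (γ.comap hf).F.val.ofConv (x ⊗ₜ y)
    rw [e] at h1
    exact h1.trans (convSandwich_comp (Coalgebra.TensorProduct.map f f) (γ.F⁻¹).val.ofConv E.mul
      γ.F.val.ofConv (x ⊗ₜ y)).symm
  map_assoc x y z := by
    suffices h : toConv (MajidData.twist (γ.comap hf)).assoc = convComap
        (Coalgebra.TensorProduct.map f (Coalgebra.TensorProduct.map f f))
        (toConv (MajidData.twist γ).assoc) from
      LinearMap.congr_fun (congrArg ofConv h) (x ⊗ₜ (y ⊗ₜ z))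
    simp only [MajidData.twist, toConv_ofConv, _root_.map_mul]
    -- The five convolution factors of the twisted reassociator are compared one by one.
    congr 1
    · congr 1
      · congr 1
        · congr 1
          · ext x y z
            simp [Gauge.comap, convComap]
          · ext x y z
            simp [Gauge.comap, convComap, hf.map_mul]
        · ext x y z
          simp [convComap, hf.map_assoc]
      · ext x y z
        simp [Gauge.comap, convComap, hf.map_mul]
    · ext x y z
      simp [Gauge.comap, convComap]

end MajidData

end Hom

/-! ### The Majid algebra `(kG, Φ)` -/

section GroupMajid

variable {k G : Type*} [Field k]

/-- A group element, as an element of the group algebra. -/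
abbrev grp (k : Type*) {G : Type*} [Field k] (g : G) : MonoidAlgebra k G := .single g 1

theorem isGroupLikeElem_grp (g : G) : IsGroupLikeElem k (grp k g) :=
  MonoidAlgebra.isGroupLikeElem_single_one g

theorem isGroupLikeElem_grp_tmul (g h : G) : IsGroupLikeElem k (grp k g ⊗ₜ[k] grp k h) :=
  IsGroupLikeElem.tmul (isGroupLikeElem_grp g) (isGroupLikeElem_grp h)

/-- The linear extension of a function on `G × G`. -/
def linExtTwo (F : G → G → k) : MonoidAlgebra k G ⊗[k] MonoidAlgebra k G →ₗ[k] k :=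
  ((MonoidAlgebra.basis G k).tensorProduct (MonoidAlgebra.basis G k)).constr k
    fun p => F p.1 p.2

theorem linExtTwo_grp (F : G → G → k) (g h : G) :
    linExtTwo F (grp k g ⊗ₜ grp k h) = F g h := by
  have := ((MonoidAlgebra.basis G k).tensorProduct (MonoidAlgebra.basis G k)).constr_basis k
    (fun p => F p.1 p.2) (g, h)
  simpa [linExtTwo] using this

theorem grp_tmul_ext {N : Type*} [AddCommGroup N] [Module k N]
    {φ ψ : MonoidAlgebra k G ⊗[k] MonoidAlgebra k G →ₗ[k] N}
    (h : ∀ e f, φ (grp k e ⊗ₜ grp k f) = ψ (grp k e ⊗ₜ grp k f)) : φ = ψ :=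
  ((MonoidAlgebra.basis G k).tensorProduct (MonoidAlgebra.basis G k)).ext fun ⟨e, f⟩ => by
    simpa using h e f

theorem convMul_linExtTwo (F F' : G → G → kˣ) (h : ∀ e f, F e f * F' e f = 1) :
    toConv (linExtTwo fun e f => (F e f : k)) * toConv (linExtTwo fun e f => (F' e f : k)) = 1 := by
  refine WithConv.ext (grp_tmul_ext fun e f => ?_)
  rw [convMul_apply_of_isGroupLikeElem (isGroupLikeElem_grp_tmul e f)]
  simp only [linExtTwo_grp]
  rw [← Units.val_mul, h]
  simp

variable [Group G]

/-- The group algebra, as a Majid algebra with reassociator `Φ`. -/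
def groupMajid (Φ : ThreeCocycle k G) : MajidData k (MonoidAlgebra k G) where
  one := 1
  mul := LinearMap.mul' k _
  assoc := ((MonoidAlgebra.basis G k).tensorProduct
    ((MonoidAlgebra.basis G k).tensorProduct (MonoidAlgebra.basis G k))).constr k
      fun p => (Φ p.1 p.2.1 p.2.2 : k)

theorem groupMajid_assoc (Φ : ThreeCocycle k G) (e f g : G) :
    (groupMajid Φ).assoc (grp k e ⊗ₜ (grp k f ⊗ₜ grp k g)) = Φ e f g := by
  have := ((MonoidAlgebra.basis G k).tensorProduct ((MonoidAlgebra.basis G k).tensorProduct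
    (MonoidAlgebra.basis G k))).constr_basis k (fun p => (Φ p.1 p.2.1 p.2.2 : k)) (e, f, g)
  simpa [groupMajid] using this

/-- The values at group elements of a convolution invertible functional, as units. -/
def unitAt {C : Type*} [AddCommGroup C] [Module k C] [Coalgebra k C]
    (F : (WithConv (C →ₗ[k] k))ˣ) {c : C} (hc : IsGroupLikeElem k c) : kˣ where
  val := F.val c
  inv := (F⁻¹).val c
  val_inv := by
    rw [← convMul_apply_of_isGroupLikeElem hc, ← Units.val_mul]; simp [hc.counit_eq_one]
  inv_val := by
    rw [← convMul_apply_of_isGroupLikeElem hc, ← Units.val_mul]; simp [hc.counit_eq_one]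

variable {Φ : ThreeCocycle k G}

/-- The restriction of a gauge transformation of `(kG, Φ)` to `G`. -/
def MajidData.Gauge.toGroup (γ : (groupMajid Φ).Gauge) : GroupGauge k G where
  toFun g h := unitAt γ.F (isGroupLikeElem_grp_tmul g h)
  one_left g := Units.ext <| (γ.left_one (grp k g)).trans (by simp)
  one_right g := Units.ext <| (γ.right_one (grp k g)).trans (by simp)

theorem MajidData.Gauge.apply_grp (γ : (groupMajid Φ).Gauge) (g h : G) :
    γ.F.val.ofConv (grp k g ⊗ₜ grp k h) = γ.toGroup g h := rfl

theorem MajidData.Gauge.inv_apply_grp (γ : (groupMajid Φ).Gauge) (g h : G) :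
    (γ.F⁻¹).val.ofConv (grp k g ⊗ₜ grp k h) = ((γ.toGroup g h)⁻¹ : kˣ) := rfl

/-- On group-like elements the five factors simply multiply, and the four that involve the gauge
transformation combine to its differential. -/
theorem twist_groupMajid_assoc (γ : (groupMajid Φ).Gauge) (e f g : G) :
    (MajidData.twist γ).assoc (grp k e ⊗ₜ (grp k f ⊗ₜ grp k g)) = Φ.twist γ.toGroup e f g := by
  have hG := IsGroupLikeElem.tmul (isGroupLikeElem_grp (k := k) e) (isGroupLikeElem_grp_tmul f g)
  simp only [MajidData.twist, convMul_apply_of_isGroupLikeElem hG]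
  simp only [LinearMap.comp_apply, TensorProduct.map_tmul, LinearMap.lTensor_tmul,
    LinearMap.rTensor_tmul, LinearEquiv.coe_coe, TensorProduct.assoc_symm_tmul, groupMajid_assoc]
  simp only [groupMajid, LinearMap.mul'_apply, MonoidAlgebra.single_mul_single, mul_one,
    γ.apply_grp, γ.inv_apply_grp, (isGroupLikeElem_grp (k := k) _).counit_eq_one]
  simp only [ThreeCocycle.twist, differential, Units.val_mul, Units.val_div_eq_div_val,
    Units.val_inv_eq_inv_val]
  field_simp

/-- The linear extension of a gauge transformation on `G`, as a unit of the convolution algebra. -/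
def GroupGauge.toUnit (F : GroupGauge k G) :
    (WithConv (MonoidAlgebra k G ⊗[k] MonoidAlgebra k G →ₗ[k] k))ˣ where
  val := toConv (linExtTwo fun e f => (F e f : k))
  inv := toConv (linExtTwo fun e f => ((F e f)⁻¹ : kˣ))
  val_inv := convMul_linExtTwo _ _ (by simp)
  inv_val := convMul_linExtTwo _ _ (by simp)

theorem GroupGauge.toUnit_apply (F : GroupGauge k G) (e f : G) :
    F.toUnit.val.ofConv (grp k e ⊗ₜ grp k f) = F e f :=
  linExtTwo_grp (fun e f => (F e f : k)) e f

variable (Φ) in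
/-- The gauge transformation of `(kG, Φ)` obtained from a gauge transformation on `G`. -/
def GroupGauge.toGauge (F : GroupGauge k G) : (groupMajid Φ).Gauge where
  F := F.toUnit
  right_one h := by
    have : F.toUnit.val.ofConv ∘ₗ
        (TensorProduct.mk k _ _).flip (groupMajid Φ).one = counit (R := k) :=
      (MonoidAlgebra.basis G k).ext fun g => by
        have := F.toUnit_apply g 1
        simpa [groupMajid, MonoidAlgebra.one_def, F.one_right] using this
    exact LinearMap.congr_fun this h
  left_one h := by
    have : F.toUnit.val.ofConv ∘ₗ
        (TensorProduct.mk k _ _) (groupMajid Φ).one = counit (R := k) :=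
      (MonoidAlgebra.basis G k).ext fun g => by
        have := F.toUnit_apply 1 g
        simpa [groupMajid, MonoidAlgebra.one_def, F.one_left] using this
    exact LinearMap.congr_fun this h

theorem GroupGauge.toGauge_toGroup (F : GroupGauge k G) (e f : G) :
    (F.toGauge Φ).toGroup e f = F e f :=
  Units.ext (F.toUnit_apply e f)

end GroupMajid

/-! ### Convolution inverses -/

section ConvolutionInverse

variable {k : Type*} [Field k] {C A : Type*} [AddCommGroup C] [Module k C] [Coalgebra k C]
  [Ring A] [Algebra k A]

/-- The sum of the convolution powers of a locally nilpotent map. -/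
theorem exists_geom_sum {n : WithConv (C →ₗ[k] A)} (hn : ∀ x, ∃ N, ∀ j ≥ N, (n ^ j) x = 0) :
    ∃ S : WithConv (C →ₗ[k] A), ∀ x, ∃ N, ∀ M ≥ N, S x = (∑ j ∈ Finset.range M, n ^ j) x := by
  choose N hN using hn
  have h : ∀ x, ∀ M ≥ N x, (∑ j ∈ Finset.range (N x), n ^ j) x =
      (∑ j ∈ Finset.range M, n ^ j) x := by
    intro x M hM
    induction M, hM using Nat.le_induction with
    | base => rfl
    | succ M hM ih =>
      rw [Finset.sum_range_succ, ih, ofConv_add, LinearMap.add_apply, hN x M hM, add_zero]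
  -- The value at `x` may be computed with any cutoff beyond `N x`. Linearity follows by passing to
  -- a common cutoff.
  refine ⟨toConv
    { toFun := fun x => (∑ j ∈ Finset.range (N x), n ^ j) x
      map_add' := fun x y => ?_
      map_smul' := fun c x => ?_ }, fun x => ⟨N x, h x⟩⟩
  · rw [h (x + y) (max (N (x + y)) (max (N x) (N y))) (by simp),
      h x (max (N (x + y)) (max (N x) (N y))) (by simp),
      h y (max (N (x + y)) (max (N x) (N y))) (by simp), map_add]
  · rw [h (c • x) (max (N (c • x)) (N x)) (by simp), h x (max (N (c • x)) (N x)) (by simp),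
      map_smul, RingHom.id_apply]

/-- The inverse is the geometric series `S`. A convolution product at `x` involves only the tensor
`comul x`, a finite sum, so there `S` can be replaced by a long partial sum and the product
telescopes to `1 - n ^ M`. -/
theorem isUnit_one_sub_of_locally_nilpotent {n : WithConv (C →ₗ[k] A)}
    (hn : ∀ x, ∃ N, ∀ j ≥ N, (n ^ j) x = 0) : IsUnit (1 - n) := by
  obtain ⟨S, hS⟩ := exists_geom_sum hn
  -- On a fixed tensor, `S` agrees with all sufficiently long partial sums; `hl` is the mirror
  -- image.
  have hr : ∀ φ : WithConv (C →ₗ[k] A), ∀ t : C ⊗[k] C, ∃ N, ∀ M ≥ N,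
      TensorProduct.map φ.ofConv S.ofConv t =
        TensorProduct.map φ.ofConv (∑ j ∈ Finset.range M, n ^ j).ofConv t := by
    intro φ t
    induction t with
    | zero => exact ⟨0, by simp⟩
    | add a b ha hb =>
      obtain ⟨N, hN⟩ := ha
      obtain ⟨N', hN'⟩ := hb
      refine ⟨max N N', fun M hM => ?_⟩
      rw [map_add, map_add, hN M (le_trans (le_max_left _ _) hM),
        hN' M (le_trans (le_max_right _ _) hM)]
    | tmul a b =>
      obtain ⟨N, hN⟩ := hS b
      exact ⟨N, fun M hM => by rw [TensorProduct.map_tmul, TensorProduct.map_tmul, hN M hM]⟩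
  have hl : ∀ φ : WithConv (C →ₗ[k] A), ∀ t : C ⊗[k] C, ∃ N, ∀ M ≥ N,
      TensorProduct.map S.ofConv φ.ofConv t =
        TensorProduct.map (∑ j ∈ Finset.range M, n ^ j).ofConv φ.ofConv t := by
    intro φ t
    induction t with
    | zero => exact ⟨0, by simp⟩
    | add a b ha hb =>
      obtain ⟨N, hN⟩ := ha
      obtain ⟨N', hN'⟩ := hb
      refine ⟨max N N', fun M hM => ?_⟩
      rw [map_add, map_add, hN M (le_trans (le_max_left _ _) hM),
        hN' M (le_trans (le_max_right _ _) hM)]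
    | tmul a b =>
      obtain ⟨N, hN⟩ := hS a
      exact ⟨N, fun M hM => by rw [TensorProduct.map_tmul, TensorProduct.map_tmul, hN M hM]⟩
  refine isUnit_iff_exists.2 ⟨S, WithConv.ext (LinearMap.ext fun x => ?_),
    WithConv.ext (LinearMap.ext fun x => ?_)⟩
  · obtain ⟨N, hN⟩ := hr (1 - n) (comul x)
    obtain ⟨N', hN'⟩ := hn x
    have h1 := hN (max N N') (le_max_left _ _)
    rw [LinearMap.convMul_apply, h1, ← LinearMap.convMul_apply, mul_neg_geom_sum, ofConv_sub,
      LinearMap.sub_apply, hN' _ (le_max_right _ _), sub_zero]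
  · obtain ⟨N, hN⟩ := hl (1 - n) (comul x)
    obtain ⟨N', hN'⟩ := hn x
    have h1 := hN (max N N') (le_max_left _ _)
    rw [LinearMap.convMul_apply, h1, ← LinearMap.convMul_apply, geom_sum_mul_neg, ofConv_sub,
      LinearMap.sub_apply, hN' _ (le_max_right _ _), sub_zero]

end ConvolutionInverse

/-! ### Majid algebras with trivial reassociator -/

namespace MajidData

variable {k : Type*} [Field k] {H : Type u} [AddCommGroup H] [Module k H] [Coalgebra k H]

/-- The axioms of a bialgebra, for the operations of a Majid algebra with trivial reassociator. -/
structure IsBialgebra (D : MajidData k H) : Prop where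
  one_mul : ∀ x, D.mul (D.one ⊗ₜ x) = x
  mul_one : ∀ x, D.mul (x ⊗ₜ D.one) = x
  mul_assoc : ∀ x y z, D.mul (D.mul (x ⊗ₜ y) ⊗ₜ z) = D.mul (x ⊗ₜ D.mul (y ⊗ₜ z))
  counit_one : counit (R := k) D.one = 1
  counit_mul : ∀ x y, counit (R := k) (D.mul (x ⊗ₜ y)) = counit (R := k) x * counit (R := k) y
  comul_one : comul (R := k) D.one = D.one ⊗ₜ D.one
  comul_mul : ∀ x y, comul (R := k) (D.mul (x ⊗ₜ y)) =
    TensorProduct.map D.mul D.mul (comul (R := k) (x ⊗ₜ[k] y))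
  assoc_eq : D.assoc = counit

/-- The axioms are identities and can be checked after applying `f`. For those with values in a
tensor square, `f ⊗ f` is still injective over a field. -/
theorem IsBialgebra.of_injective {C : Type*} [AddCommGroup C] [Module k C] [Coalgebra k C]
    {D : MajidData k C} {E : MajidData k H} {f : C →ₗc[k] H} (hf : IsHom D E f)
    (inj : Function.Injective f) (hE : E.IsBialgebra) : D.IsBialgebra where
  one_mul x := inj (by rw [hf.map_mul, hf.map_one, hE.one_mul])
  mul_one x := inj (by rw [hf.map_mul, hf.map_one, hE.mul_one])
  mul_assoc x y z := inj (by simp only [hf.map_mul, hE.mul_assoc])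
  counit_one := by rw [← CoalgHomClass.counit_comp_apply f, hf.map_one, hE.counit_one]
  counit_mul x y := by
    rw [← CoalgHomClass.counit_comp_apply f, hf.map_mul, hE.counit_mul]; simp
  comul_one := by
    apply TensorProduct.map_injective_of_flat_flat f.toLinearMap f.toLinearMap inj inj
    refine (CoalgHomClass.map_comp_comul_apply f _).trans ?_
    rw [hf.map_one, hE.comul_one, TensorProduct.map_tmul]
    exact congrArg₂ _ hf.map_one.symm hf.map_one.symm
  comul_mul x y := by
    apply TensorProduct.map_injective_of_flat_flat f.toLinearMap f.toLinearMap inj inj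
    refine (CoalgHomClass.map_comp_comul_apply f _).trans ?_
    rw [hf.map_mul, hE.comul_mul]
    have e : E.mul ∘ₗ (Coalgebra.TensorProduct.map f f).toLinearMap = f.toLinearMap ∘ₗ D.mul :=
      TensorProduct.ext' fun x y => (hf.map_mul x y).symm
    have h := CoalgHomClass.map_comp_comul_apply (Coalgebra.TensorProduct.map f f) (x ⊗ₜ[k] y)
    rw [Coalgebra.TensorProduct.map_tmul] at h
    rw [← h]
    have h2 := LinearMap.congr_fun (TensorProduct.map_comp E.mul E.mul
      (Coalgebra.TensorProduct.map f f).toLinearMap (Coalgebra.TensorProduct.map f f).toLinearMap)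
      (comul (R := k) (x ⊗ₜ[k] y))
    rw [e, TensorProduct.map_comp] at h2
    exact h2.symm
  assoc_eq := TensorProduct.ext' fun x t => by
    induction t with
    | zero => simp
    | add a b ha hb => simp only [TensorProduct.tmul_add, map_add, ha, hb]
    | tmul y z => rw [hf.map_assoc, hE.assoc_eq]; simp

variable {D : MajidData k H} (hD : D.IsBialgebra)

/-- The ring structure of a bialgebra. -/
@[reducible]
def IsBialgebra.ring : Ring H where
  __ := (inferInstance : AddCommGroup H)
  mul x y := D.mul (x ⊗ₜ y)
  one := D.one
  one_mul := hD.one_mul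
  mul_one := hD.mul_one
  mul_assoc := hD.mul_assoc
  left_distrib x y z := by
    change D.mul (x ⊗ₜ (y + z)) = D.mul (x ⊗ₜ y) + D.mul (x ⊗ₜ z)
    rw [TensorProduct.tmul_add, map_add]
  right_distrib x y z := by
    change D.mul ((x + y) ⊗ₜ z) = D.mul (x ⊗ₜ z) + D.mul (y ⊗ₜ z)
    rw [TensorProduct.add_tmul, map_add]
  zero_mul x := by
    change D.mul (0 ⊗ₜ x) = 0
    simp
  mul_zero x := by
    change D.mul (x ⊗ₜ 0) = 0
    simp

/-- The algebra structure of a bialgebra. -/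
@[reducible]
def IsBialgebra.algebra : letI := hD.ring; Algebra k H :=
  letI := hD.ring
  Algebra.ofModule (fun r x y => by
      change D.mul ((r • x) ⊗ₜ y) = r • D.mul (x ⊗ₜ y)
      rw [← TensorProduct.smul_tmul', map_smul])
    (fun r x y => by
      change D.mul (x ⊗ₜ (r • y)) = r • D.mul (x ⊗ₜ y)
      rw [TensorProduct.tmul_smul, map_smul])

/-- The bialgebra structure. -/
@[reducible]
def IsBialgebra.bialgebra : letI := hD.ring; Bialgebra k H :=
  letI := hD.ring
  letI := hD.algebra
  Bialgebra.mk' k H hD.counit_one (hD.counit_mul _ _) hD.comul_one (by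
    intro x y
    refine (hD.comul_mul x y).trans ?_
    rw [TensorProduct.comul_tmul]
    induction comul (R := k) x with
    | zero => rw [TensorProduct.zero_tmul, LinearEquiv.map_zero, LinearMap.map_zero, zero_mul]
    | add a b ha hb =>
      rw [TensorProduct.add_tmul, LinearEquiv.map_add, LinearMap.map_add, ha, hb, add_mul]
    | tmul a b =>
      induction comul (R := k) y with
      | zero => rw [TensorProduct.tmul_zero, LinearEquiv.map_zero, LinearMap.map_zero, mul_zero]
      | add a b ha hb =>
        rw [TensorProduct.tmul_add, LinearEquiv.map_add, LinearMap.map_add, ha, hb, mul_add]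
      | tmul c d => exact (Algebra.TensorProduct.tmul_mul_tmul a c b d).symm)

/-- A bialgebra whose identity map is convolution invertible is a Hopf algebra. -/
theorem IsBialgebra.exists_isIsomorphic_ofHopfAlgebra
    (hS : letI := hD.ring; letI := hD.algebra; IsUnit (toConv (LinearMap.id : H →ₗ[k] H))) :
    ∃ (A : Type u) (_ : Ring A) (_ : HopfAlgebra k A),
      D.IsIsomorphic (ofHopfAlgebra (k := k) A) := by
  let _ := hD.ring
  let _ := hD.bialgebra
  -- The antipode is the convolution inverse of the identity.
  obtain ⟨S, hS1, hS2⟩ := isUnit_iff_exists.1 hS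
  let _ : HopfAlgebra k H :=
    { antipode := S.ofConv
      mul_antipode_rTensor_comul := congrArg ofConv hS2
      mul_antipode_lTensor_comul := congrArg ofConv hS1 }
  refine ⟨H, _, inferInstance, CoalgEquiv.refl k H, rfl, fun x y => rfl, fun x y z => ?_⟩
  rw [hD.assoc_eq]; rfl

end MajidData

/-! ### The path coalgebra: vertices, the degree zero projection and the length filtration -/

theorem APath.len_add_len_of_mem_splits {G : Type*} {ι : G → G → Type*} {x z : G}
    {p : APath ι x z} {t : Σ y : G, APath ι y z × APath ι x y} (ht : t ∈ p.splits) :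
    t.2.1.len + t.2.2.len = p.len := by
  induction p with
  | triv =>
    simp only [APath.splits, List.mem_singleton] at ht
    subst ht; rfl
  | snoc p e ih =>
    simp only [APath.splits, List.mem_cons, List.mem_map] at ht
    obtain rfl | ⟨s, hs, rfl⟩ := ht
    · simp [APath.len]
    · have := ih hs
      simp only [APath.len]; omega

/-- This makes the vertices group-like in any subcoalgebra containing them, without computing its
comultiplication. -/
theorem isGroupLikeElem_of_map_injective {k C H : Type*} [Field k] [AddCommGroup C] [Module k C]
    [Coalgebra k C] [AddCommGroup H] [Module k H] [Coalgebra k H] {f : C →ₗc[k] H}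
    (inj : Function.Injective f) {c : C} (hc : IsGroupLikeElem k (f c)) :
    IsGroupLikeElem k c where
  counit_eq_one := by rw [← CoalgHomClass.counit_comp_apply f, hc.counit_eq_one]
  comul_eq_tmul_self := by
    apply TensorProduct.map_injective_of_flat_flat f.toLinearMap f.toLinearMap inj inj
    refine (CoalgHomClass.map_comp_comul_apply f _).trans ?_
    rw [hc.comul_eq_tmul_self, TensorProduct.map_tmul]
    rfl

namespace PathCoalgebra

variable {k G : Type*} [Field k] {ι : G → G → Type*}

variable (k ι) in
/-- A vertex, as an element of the path coalgebra. -/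
def vertex (g : G) : PathCoalgebra k ι := of k (.triv : APath ι g g)

theorem isGroupLikeElem_vertex (g : G) : IsGroupLikeElem k (vertex k ι g) where
  counit_eq_one := by simp [vertex, counit_of, APath.len]
  comul_eq_tmul_self := by simp [vertex, comul_of, APath.splits]

theorem hom_ext {N : Type*} [AddCommGroup N] [Module k N] {φ ψ : PathCoalgebra k ι →ₗ[k] N}
    (h : ∀ (x y : G) (p : APath ι x y), φ (of k p) = ψ (of k p)) : φ = ψ :=
  (basis k ι).ext fun ⟨x, y, p⟩ => h x y p

theorem comul_snoc {x y z : G} (p : APath ι x y) (e : ι z y) :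
    comul (R := k) (of k (p.snoc e)) = vertex k ι z ⊗ₜ of k (p.snoc e) +
      (p.splits.map fun t => of k (t.2.1.snoc e) ⊗ₜ[k] of k t.2.2).sum := by
  simp [comul_of, APath.splits, vertex, Function.comp_def]

variable (k ι) in
/-- The projection to degree zero, as a linear map to the group algebra. -/
def toGroupLin : PathCoalgebra k ι →ₗ[k] MonoidAlgebra k G :=
  (basis k ι).constr k fun s => if s.2.2.len = 0 then grp k s.1 else 0

theorem toGroupLin_of {x y : G} (p : APath ι x y) :
    toGroupLin k ι (of k p) = if p.len = 0 then grp k x else 0 := by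
  simp [toGroupLin, of]

theorem toGroupLin_snoc {x y z : G} (p : APath ι x y) (e : ι z y) :
    toGroupLin k ι (of k (p.snoc e)) = 0 := by
  simp [toGroupLin_of, APath.len]

/-- In `β ⊗ α` the left factor is the terminal piece. Only the splitting with `β` trivial survives,
and `β` is then the end point of `p`. -/
theorem rTensor_toGroupLin_comul {x y : G} (p : APath ι x y) :
    (toGroupLin k ι).rTensor _ (comul (R := k) (of k p)) = grp k y ⊗ₜ of k p := by
  cases p with
  | triv => simp [comul_of, APath.splits, toGroupLin_of, APath.len]
  | snoc p e =>
    simp only [comul_snoc, map_add, LinearMap.rTensor_tmul, map_list_sum, List.map_map,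
      Function.comp_def, toGroupLin_snoc]
    simp [vertex, toGroupLin_of, APath.len]

/-- Dually, only the splitting with trivial initial piece survives, which leaves the starting point.
-/
theorem lTensor_toGroupLin_comul {x y : G} (p : APath ι x y) :
    (toGroupLin k ι).lTensor _ (comul (R := k) (of k p)) = of k p ⊗ₜ grp k x := by
  have := sum_splits_len p (fun _ β _ => of k β ⊗ₜ[k] grp k x)
  rw [← this, comul_of]
  simp only [map_list_sum, List.map_map, Function.comp_def, LinearMap.lTensor_tmul, toGroupLin_of]
  refine congrArg List.sum (List.map_congr_left fun t _ => ?_)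
  split_ifs <;> simp

variable (k ι) in
/-- The projection to degree zero, as a coalgebra morphism to the group algebra. -/
def toGroup : PathCoalgebra k ι →ₗc[k] MonoidAlgebra k G where
  __ := toGroupLin k ι
  counit_comp := hom_ext fun x y p => by
    simp only [LinearMap.comp_apply, toGroupLin_of, counit_of]
    split_ifs <;> simp
  map_comp_comul := hom_ext fun x y p => by
    -- Projecting one tensor factor at a time reduces to the one-sided formula.
    have e : TensorProduct.map (toGroupLin k ι) (toGroupLin k ι) =
        (toGroupLin k ι).lTensor _ ∘ₗ (toGroupLin k ι).rTensor _ := by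
      simp [LinearMap.lTensor, LinearMap.rTensor, ← TensorProduct.map_comp]
    simp only [LinearMap.comp_apply, e, rTensor_toGroupLin_comul, LinearMap.lTensor_tmul]
    cases p with
    | triv => simp [toGroupLin_of, APath.len]
    | snoc p e => simp [toGroupLin_snoc]

@[simp] theorem toGroup_vertex (g : G) : toGroup k ι (vertex k ι g) = grp k g := by
  change toGroupLin k ι (of k _) = _
  simp [toGroupLin_of, APath.len]

theorem toGroup_snoc {x y z : G} (p : APath ι x y) (e : ι z y) :
    toGroup k ι (of k (p.snoc e)) = 0 := toGroupLin_snoc p e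

/-! ### Convolution invertibility on subcoalgebras of the path coalgebra -/

section Nilpotent

variable {A : Type*} [Ring A] [Algebra k A]

/-- The power `n ^ j` evaluates `n` on `j` consecutive pieces of the path. If the path has fewer
than `j` arrows, one of these pieces is a vertex. -/
theorem conv_pow_of_eq_zero {n : WithConv (PathCoalgebra k ι →ₗ[k] A)}
    (hn : ∀ g, n (vertex k ι g) = 0) (j : ℕ) {x y : G} (p : APath ι x y) (hp : p.len < j) :
    (n ^ j) (of k p) = 0 := by
  induction j generalizing x y with
  | zero => simp at hp
  | succ j ih =>
    rw [pow_succ', LinearMap.convMul_apply, comul_of, map_list_sum, map_list_sum, List.map_map,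
      List.map_map]
    refine List.sum_eq_zero fun a ha => ?_
    obtain ⟨⟨y, β, α⟩, ht, rfl⟩ := List.mem_map.1 ha
    have hl := APath.len_add_len_of_mem_splits ht
    simp only [Function.comp_apply, TensorProduct.map_tmul, LinearMap.mul'_apply]
    cases β with
    | triv => rw [show n.ofConv (of k .triv) = 0 from hn _, zero_mul]
    | snoc β e =>
      simp only [APath.len] at hl
      rw [ih α (by omega), mul_zero]

theorem conv_locally_nilpotent {n : WithConv (PathCoalgebra k ι →ₗ[k] A)}
    (hn : ∀ g, n (vertex k ι g) = 0) (x : PathCoalgebra k ι) : ∃ N, ∀ j ≥ N, (n ^ j) x = 0 := by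
  induction (basis k ι).mem_span x using Submodule.span_induction with
  | zero => exact ⟨0, by simp⟩
  | mem x hx =>
    obtain ⟨i, rfl⟩ := hx
    exact ⟨i.2.2.len + 1, fun j hj => conv_pow_of_eq_zero hn j i.2.2 (by omega)⟩
  | add a b _ _ ha hb =>
    obtain ⟨N, hN⟩ := ha
    obtain ⟨N', hN'⟩ := hb
    exact ⟨max N N', fun j hj => by
      rw [map_add, hN j (le_trans (le_max_left _ _) hj), hN' j (le_trans (le_max_right _ _) hj),
        add_zero]⟩
  | smul c a _ ha =>
    obtain ⟨N, hN⟩ := ha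
    exact ⟨N, fun j hj => by rw [map_smul, hN j hj, smul_zero]⟩

variable {W : Type*} [AddCommGroup W] [Module k W] [Coalgebra k W]
  {i : W →ₗc[k] PathCoalgebra k ι}

/-- Since `1 - f` vanishes at the vertices, it is locally nilpotent by the length filtration, and
the geometric series inverts `f`. Both hypotheses on vertices serve to see this vanishing in `kQ`.
-/
theorem isUnit_of_eq_one_at_vertices (inj : Function.Injective i)
    {f : WithConv (W →ₗ[k] A)}
    (hf : ∀ w g, i w = vertex k ι g → f w = 1) (hi : ∀ g, ∃ w, i w = vertex k ι g) :
    IsUnit f := by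
  obtain ⟨r, hr⟩ := i.toLinearMap.exists_leftInverse_of_injective (LinearMap.ker_eq_bot.2 inj)
  -- `r` is only a linear retraction, but this suffices: `1 - f` is the pullback of `n` along the
  -- coalgebra morphism `i`, so nilpotency can be tested for `n` on paths.
  set n : WithConv (PathCoalgebra k ι →ₗ[k] A) := toConv ((1 - f).ofConv ∘ₗ r)
  have hr' : ∀ w, r (i w) = w := fun w => LinearMap.congr_fun hr w
  have hn : 1 - f = convComap i n :=
    WithConv.ext (LinearMap.ext fun w => by simp [n, hr'])
  have hv : ∀ g, n (vertex k ι g) = 0 := fun g => by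
    obtain ⟨w, hw⟩ := hi g
    have hc : counit (R := k) w = 1 := by
      rw [← CoalgHomClass.counit_comp_apply i, hw, (isGroupLikeElem_vertex g).counit_eq_one]
    rw [← hw]
    simp [n, hr', hf w g hw, hc]
  have := isUnit_one_sub_of_locally_nilpotent (n := 1 - f) fun w => by
    obtain ⟨N, hN⟩ := conv_locally_nilpotent hv (i w)
    exact ⟨N, fun j hj => by rw [hn, ← map_pow]; exact hN j hj⟩
  rwa [sub_sub_cancel] at this

/-- A linear map which takes invertible values at the vertices is convolution invertible. -/
theorem isUnit_of_isUnit_at_vertices (inj : Function.Injective i)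
    {f : WithConv (W →ₗ[k] A)} {v : G → W}
    (hv : ∀ g, i (v g) = vertex k ι g) (hf : ∀ g, IsUnit (f (v g))) : IsUnit f := by
  choose u hu using hf
  -- An inverse of `f` in degree zero, extended by zero to positive length.
  set f' : WithConv (W →ₗ[k] A) := toConv
    ((MonoidAlgebra.basis G k).constr k (fun g => ((u g)⁻¹.val : A)) ∘ₗ
      (toGroup k ι).toLinearMap ∘ₗ i.toLinearMap)
  have hf' : ∀ g, f' (v g) = (u g)⁻¹.val := fun g => by
    have h1 := (MonoidAlgebra.basis G k).constr_basis k (fun g => ((u g)⁻¹.val : A)) g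
    rw [MonoidAlgebra.basis_apply] at h1
    have h2 : toGroup k ι (i (v g)) = grp k g := by rw [hv, toGroup_vertex]
    exact (congrArg ((MonoidAlgebra.basis G k).constr k fun g => ((u g)⁻¹.val : A)) h2).trans h1
  have hG : ∀ g, IsGroupLikeElem k (v g) := fun g =>
    isGroupLikeElem_of_map_injective inj (by rw [hv]; exact isGroupLikeElem_vertex g)
  have hw : ∀ w g, i w = vertex k ι g → w = v g := fun w g h => inj (h.trans (hv g).symm)
  have hi : ∀ g, ∃ w, i w = vertex k ι g := fun g => ⟨v g, hv g⟩
  have h1 : IsUnit (f * f') := isUnit_of_eq_one_at_vertices inj (fun w g h => by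
    rw [hw w g h, convMul_apply_of_isGroupLikeElem (hG g), hf', ← hu, Units.mul_inv]) hi
  have h2 : IsUnit (f' * f) := isUnit_of_eq_one_at_vertices inj (fun w g h => by
    rw [hw w g h, convMul_apply_of_isGroupLikeElem (hG g), hf', ← hu, Units.inv_mul]) hi
  obtain ⟨a, ha⟩ := h1.exists_right_inv
  obtain ⟨b, hb⟩ := h2.exists_left_inv
  -- A right inverse and a left inverse of `f` coincide.
  have hab : f' * a = b * f' := by
    calc f' * a = b * (f' * f) * (f' * a) := by rw [hb, one_mul]
      _ = b * f' * (f * f' * a) := by simp only [mul_assoc]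
      _ = b * f' := by rw [ha, mul_one]
  exact isUnit_iff_exists.2 ⟨f' * a, by rw [← mul_assoc, ha], by rw [hab, mul_assoc, hb]⟩

end Nilpotent

end PathCoalgebra

open PathCoalgebra

/-! ### The multiplication of paths, in terms of appending elements of the bimodule -/

section Append

variable {k G : Type*} [Field k] [Group G] {Φ : ThreeCocycle k G} {M : Type*} [AddCommGroup M]
  [Module k M]

namespace MajidBimodule

variable (B : MajidBimodule Φ M) {ι : G → G → Type*}
  (b : ∀ g h, Module.Basis (ι g h) k (B.comp g h))

open Classical in
/-- The projection to an isotypic component. -/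
def proj (z y : G) : M →ₗ[k] B.comp z y :=
  (contrL B.coactL (Pi.single z 1) ∘ₗ contrR B.coactR (Pi.single y 1)).codRestrict _ fun m => by
    refine ⟨B.coactL_contrL z _, ?_⟩
    have := B.coactR_contrL (Pi.single z 1) (contrR B.coactR (Pi.single y 1) m)
    rw [B.coactR_contrR] at this
    exact this

variable {B}

theorem proj_self {z y : G} {m : M} (hm : m ∈ B.comp z y) : B.proj z y m = ⟨m, hm⟩ :=
  Subtype.ext <| by
    change contrL B.coactL _ (contrR B.coactR _ m) = m
    simp [contrR_comp hm, contrL_comp hm]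

theorem proj_of_ne {z y y' : G} {m : M} (hm : m ∈ B.comp z y) (h : y' ≠ y) :
    B.proj z y' m = 0 :=
  Subtype.ext <| by
    change contrL B.coactL _ (contrR B.coactR _ m) = 0
    simp [contrR_comp hm, h.symm]

variable (B)

/-- Append to a combination of paths an element of the bimodule, regarded as a combination of
arrows with end point `z`. -/
def app (z : G) : PathCoalgebra k ι →ₗ[k] M →ₗ[k] PathCoalgebra k ι :=
  (basis k ι).constr k fun s =>
    (b z s.2.1).constr k (fun e => of k (s.2.2.snoc e)) ∘ₗ B.proj z s.2.1

variable {B}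

theorem app_of (z : G) {x y : G} (p : APath ι x y) (m : M) :
    B.app b z (of k p) m = (b z y).constr k (fun e => of k (p.snoc e)) (B.proj z y m) := by
  simp [app, of]

theorem app_of_basis {x y z : G} (p : APath ι x y) (e : ι z y) :
    B.app b z (of k p) (b z y e) = of k (p.snoc e) := by
  rw [app_of, proj_self (b z y e).2]
  exact (b z y).constr_basis k _ e

theorem app_of_ne {x y y' z : G} (p : APath ι x y) {m : M} (hm : m ∈ B.comp z y') (h : y ≠ y') :
    B.app b z (of k p) m = 0 := by
  rw [app_of, proj_of_ne hm h, map_zero]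

/-- To prove a property of pairs which is linear in both arguments, it suffices to consider
paths and arrows. -/
theorem path_arrow_induction {z y : G} {P : PathCoalgebra k ι → M → Prop}
    (h : ∀ x y' (p : APath ι x y') (e : ι z y), P (of k p) (b z y e))
    (zero_left : ∀ m, P 0 m) (zero_right : ∀ u, P u 0)
    (add_left : ∀ u v m, P u m → P v m → P (u + v) m)
    (add_right : ∀ u m n, P u m → P u n → P u (m + n))
    (smul_left : ∀ (c : k) u m, P u m → P (c • u) m)
    (smul_right : ∀ (c : k) u m, P u m → P u (c • m))
    (u : PathCoalgebra k ι) {m : M} (hm : m ∈ B.comp z y) : P u m := by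
  obtain ⟨m, rfl⟩ : ∃ m' : B.comp z y, (m' : M) = m := ⟨⟨m, hm⟩, rfl⟩
  induction (basis k ι).mem_span u using Submodule.span_induction with
  | zero => exact zero_left _
  | add a b _ _ ha hb => exact add_left _ _ _ ha hb
  | smul c a _ ha => exact smul_left _ _ _ ha
  | mem u hu =>
    obtain ⟨⟨x, y', p⟩, rfl⟩ := hu
    induction (b z y).mem_span m using Submodule.span_induction with
    | zero => exact zero_right _
    | add a b _ _ ha hb => exact add_right _ _ _ (ha a.2) (hb b.2)
    | smul c a _ ha => exact smul_right _ _ _ (ha a.2)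
    | mem m he =>
      obtain ⟨e, rfl⟩ := he
      exact h x y' p e

variable (B) in
/-- The multiplication of the path coalgebra, as a bilinear map. -/
def pmul : PathCoalgebra k ι →ₗ[k] PathCoalgebra k ι →ₗ[k] PathCoalgebra k ι :=
  TensorProduct.curry (B.pathMulMap b)

/-- The element of the path coalgebra given by a combination of paths with fixed end points. -/
def toPaths (x y : G) : (APath ι x y →₀ k) →ₗ[k] PathCoalgebra k ι :=
  Finsupp.linearCombination k (of k)

theorem pmul_of {x y z w : G} (p : APath ι x y) (q : APath ι z w) :
    B.pmul b (of k p) (of k q) = toPaths _ _ (B.pathMul b p q) := by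
  simp [pmul, pathMulMap, of, toPaths, Finsupp.linearCombination_apply]

/-- This passes from coordinates to the bilinear operation `app`. From here on the product is
handled through `app`, and the basis of arrows plays almost no role. -/
theorem toPaths_snocLin {x y z : G} (f : APath ι x y →₀ k) {m : M} (hm : m ∈ B.comp z y) :
    toPaths _ _ (snocLin f ((b z y).repr ⟨m, hm⟩)) = B.app b z (toPaths _ _ f) m := by
  induction f using Finsupp.induction_linear with
  | zero => simp [snocLin]
  | add f g hf hg =>
    rw [map_add, map_add, LinearMap.add_apply, ← hf, ← hg, ← map_add]
    congr 1
    exact Finsupp.sum_add_index' (by simp) (by simp [add_mul, Finsupp.sum_add])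
  | single p c =>
    have h : toPaths _ _ (Finsupp.single p c) = c • of k p := by simp [toPaths]
    rw [h, map_smul, LinearMap.smul_apply, app_of, proj_self hm, snocLin,
      Finsupp.sum_single_index (by simp), Module.Basis.constr_apply, Finsupp.smul_sum,
      Finsupp.sum, Finsupp.sum, map_sum]
    refine Finset.sum_congr rfl fun e _ => ?_
    rw [toPaths, Finsupp.linearCombination_single, mul_smul]

theorem app_toPaths_of_ne {x y y' z : G} (f : APath ι x y →₀ k) {m : M} (hm : m ∈ B.comp z y')
    (h : y ≠ y') : B.app b z (toPaths _ _ f) m = 0 := by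
  simp [toPaths, Finsupp.linearCombination_apply, Finsupp.sum, app_of_ne b _ hm h]

theorem pmul_vertex_vertex (g h : G) :
    B.pmul b (vertex k ι g) (vertex k ι h) = vertex k ι (g * h) := by
  rw [vertex, vertex, pmul_of, pathMul]
  simp [toPaths, vertex]

theorem pmul_snoc_vertex {x y z : G} (p : APath ι x y) (e : ι z y) (w : G) :
    B.pmul b (of k (p.snoc e)) (vertex k ι w) =
      B.app b (z * w) (B.pmul b (of k p) (vertex k ι w)) (B.ract w (b z y e)) := by
  rw [vertex, pmul_of, pmul_of, pathMul, arrowR, toPaths_snocLin]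

theorem pmul_vertex_snoc {x y z : G} (p : APath ι x y) (e : ι z y) (w : G) :
    B.pmul b (vertex k ι w) (of k (p.snoc e)) =
      B.app b (w * z) (B.pmul b (vertex k ι w) (of k p)) (B.lact w (b z y e)) := by
  rw [vertex, pmul_of, pmul_of, pathMul, arrowL, toPaths_snocLin]

theorem pmul_snoc_snoc {x y z x' y' z' : G} (p : APath ι x y) (e : ι z y) (p' : APath ι x' y')
    (e' : ι z' y') :
    B.pmul b (of k (p.snoc e)) (of k (p'.snoc e')) =
      B.app b (z * z') (B.pmul b (of k p) (of k (p'.snoc e'))) (B.ract z' (b z y e)) +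
      B.app b (z * z') (B.pmul b (of k (p.snoc e)) (of k p')) (B.lact z (b z' y' e')) := by
  rw [pmul_of, pmul_of, pmul_of, pathMul, arrowR, arrowL, map_add, toPaths_snocLin,
    toPaths_snocLin]

/-- The recursion for paths and arrows extends bilinearly. This is needed because acting on an arrow
gives a combination of arrows, and a product of paths is a combination of paths. -/
theorem pmul_app_vertex {z y : G} (u : PathCoalgebra k ι) {m : M} (hm : m ∈ B.comp z y) (w : G) :
    B.pmul b (B.app b z u m) (vertex k ι w) =
      B.app b (z * w) (B.pmul b u (vertex k ι w)) (B.ract w m) := by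
  refine path_arrow_induction b (P := fun u m => B.pmul b (B.app b z u m) (vertex k ι w) =
    B.app b (z * w) (B.pmul b u (vertex k ι w)) (B.ract w m)) ?_ ?_ ?_ ?_ ?_ ?_ ?_ u hm
  · intro x y' p e
    by_cases h : y' = y
    · subst h
      rw [app_of_basis, pmul_snoc_vertex]
    -- If path and arrow do not match, both sides vanish: by cancellation in `G` they still do not
    -- match after multiplication by `w`.
    · rw [app_of_ne b p (b z y e).2 h, vertex, pmul_of,
        app_toPaths_of_ne b _ (ract_mem (b z y e).2 w) (by simpa using h)]
      simp
  · simp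
  · simp
  · intro u v m h1 h2; simp only [map_add, LinearMap.add_apply, h1, h2]
  · intro u v m h1 h2; simp only [map_add, LinearMap.add_apply, h1, h2]
  · intro c u m h; simp only [map_smul, LinearMap.smul_apply, h]
  · intro c u m h; simp only [map_smul, LinearMap.smul_apply, h]

theorem pmul_vertex_app {z y : G} (u : PathCoalgebra k ι) {m : M} (hm : m ∈ B.comp z y) (w : G) :
    B.pmul b (vertex k ι w) (B.app b z u m) =
      B.app b (w * z) (B.pmul b (vertex k ι w) u) (B.lact w m) := by
  refine path_arrow_induction b (P := fun u m => B.pmul b (vertex k ι w) (B.app b z u m) =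
    B.app b (w * z) (B.pmul b (vertex k ι w) u) (B.lact w m)) ?_ ?_ ?_ ?_ ?_ ?_ ?_ u hm
  · intro x y' p e
    by_cases h : y' = y
    · subst h
      rw [app_of_basis, pmul_vertex_snoc]
    · rw [app_of_ne b p (b z y e).2 h, vertex, pmul_of,
        app_toPaths_of_ne b _ (lact_mem (b z y e).2 w) (by simpa using h)]
      simp
  · simp
  · simp
  · intro u v m h1 h2; simp only [map_add, LinearMap.add_apply, h1, h2]
  · intro u v m h1 h2; simp only [map_add, h1, h2]
  · intro c u m h; simp only [map_smul, LinearMap.smul_apply, h]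
  · intro c u m h; simp only [map_smul, h]

theorem pmul_app_app {z y z' y' : G} (u u' : PathCoalgebra k ι) {m m' : M} (hm : m ∈ B.comp z y)
    (hm' : m' ∈ B.comp z' y') :
    B.pmul b (B.app b z u m) (B.app b z' u' m') =
      B.app b (z * z') (B.pmul b u (B.app b z' u' m')) (B.ract z' m) +
      B.app b (z * z') (B.pmul b (B.app b z u m) u') (B.lact z m') := by
  refine path_arrow_induction b (P := fun u m => B.pmul b (B.app b z u m) (B.app b z' u' m') =
      B.app b (z * z') (B.pmul b u (B.app b z' u' m')) (B.ract z' m) +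
      B.app b (z * z') (B.pmul b (B.app b z u m) u') (B.lact z m')) ?_ ?_ ?_ ?_ ?_ ?_ ?_ u hm
  · intro x yp p e
    refine path_arrow_induction b (P := fun u' m' =>
        B.pmul b (B.app b z (of k p) (b z y e)) (B.app b z' u' m') =
      B.app b (z * z') (B.pmul b (of k p) (B.app b z' u' m')) (B.ract z' (b z y e)) +
      B.app b (z * z') (B.pmul b (B.app b z (of k p) (b z y e)) u') (B.lact z m'))
      ?_ ?_ ?_ ?_ ?_ ?_ ?_ u' hm'
    · intro x' yp' p' e'
      -- Only the case where both pairs match is the recursion. A mismatched pair contributes zero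
      -- on both sides.
      by_cases h' : yp' = y'
      · subst h'
        rw [app_of_basis]
        by_cases h : yp = y
        · subst h
          rw [app_of_basis, pmul_snoc_snoc]
        · rw [app_of_ne b p (b z y e).2 h, pmul_of,
            app_toPaths_of_ne b _ (ract_mem (b z y e).2 z') (by simpa using h)]
          simp
      · rw [app_of_ne b p' (b z' y' e').2 h']
        by_cases h : yp = y
        · subst h
          rw [app_of_basis, pmul_of b (p.snoc e) p',
            app_toPaths_of_ne b _ (lact_mem (b z' y' e').2 z) (by simpa using h')]
          simp
        · rw [app_of_ne b p (b z y e).2 h]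
          simp
    · simp
    · simp
    · intro u v m h1 h2; simp only [map_add, LinearMap.add_apply, h1, h2]; abel
    · intro u v m h1 h2; simp only [map_add, LinearMap.add_apply, h1, h2]; abel
    · intro c u m h; simp only [map_smul, LinearMap.smul_apply, h, smul_add]
    · intro c u m h; simp only [map_smul, LinearMap.smul_apply, h, smul_add]
  · simp
  · simp
  · intro u v m h1 h2; simp only [map_add, LinearMap.add_apply, h1, h2]; abel
  · intro u v m h1 h2; simp only [map_add, LinearMap.add_apply, h1, h2]; abel
  · intro c u m h; simp only [map_smul, LinearMap.smul_apply, h, smul_add]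
  · intro c u m h; simp only [map_smul, LinearMap.smul_apply, h, smul_add]

end MajidBimodule

end Append

/-! ### The axioms of a bialgebra for the path coalgebra of a Hopf bimodule -/

section PathBialgebra

variable {k G : Type*} [Field k] {ι : G → G → Type*}

theorem PathCoalgebra.path_induction {P : PathCoalgebra k ι → Prop}
    (path : ∀ (x y : G) (p : APath ι x y), P (of k p)) (zero : P 0)
    (add : ∀ u v, P u → P v → P (u + v)) (smul : ∀ (c : k) u, P u → P (c • u))
    (u : PathCoalgebra k ι) : P u := by
  induction (basis k ι).mem_span u using Submodule.span_induction with
  | zero => exact zero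
  | add a b _ _ ha hb => exact add _ _ ha hb
  | smul c a _ ha => exact smul _ _ ha
  | mem u hu =>
    obtain ⟨⟨x, y, p⟩, rfl⟩ := hu
    exact path x y p

variable [Group G] {Φ : ThreeCocycle k G} {M : Type*} [AddCommGroup M] [Module k M]

namespace MajidBimodule

variable {B : MajidBimodule Φ M} (b : ∀ g h, Module.Basis (ι g h) k (B.comp g h))

theorem toGroup_app (z : G) (u : PathCoalgebra k ι) (m : M) :
    toGroup k ι (B.app b z u m) = 0 := by
  have h : (toGroup k ι).toLinearMap ∘ₗ (B.app b z).flip m = 0 := PathCoalgebra.hom_ext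
    fun x y p => by
      have h2 : (toGroup k ι).toLinearMap ∘ₗ (b z y).constr k (fun e => of k (p.snoc e)) = 0 :=
        (b z y).ext fun e => by
          rw [LinearMap.comp_apply, Module.Basis.constr_basis]
          exact toGroup_snoc p e
      rw [LinearMap.comp_apply, LinearMap.flip_apply, app_of]
      exact LinearMap.congr_fun h2 _
  exact LinearMap.congr_fun h u

/-- If either path has positive length, every term of the product ends with an appended arrow, which
the projection kills. -/
theorem toGroup_pmul (u v : PathCoalgebra k ι) :
    toGroup k ι (B.pmul b u v) = toGroup k ι u * toGroup k ι v := by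
  induction u using PathCoalgebra.path_induction with
  | zero => simp
  | add u u' h h' => rw [map_add, map_add, LinearMap.add_apply, map_add, h, h', add_mul]
  | smul c u h => rw [map_smul, map_smul, LinearMap.smul_apply, map_smul, h, smul_mul_assoc]
  | path x y p =>
    induction v using PathCoalgebra.path_induction with
    | zero => simp
    | add u u' h h' => rw [map_add, map_add, map_add, h, h', mul_add]
    | smul c u h => rw [map_smul, map_smul, map_smul, h, mul_smul_comm]
    | path z w q =>
      cases p with
      | triv =>
        cases q with
        | triv =>
          change toGroup k ι (B.pmul b (vertex k ι _) (vertex k ι _)) =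
            toGroup k ι (vertex k ι _) * toGroup k ι (vertex k ι _)
          simp [pmul_vertex_vertex]
        | snoc q e =>
          change toGroup k ι (B.pmul b (vertex k ι _) _) = _
          rw [pmul_vertex_snoc, toGroup_app, toGroup_snoc, mul_zero]
      | snoc p e =>
        cases q with
        | triv =>
          change toGroup k ι (B.pmul b _ (vertex k ι _)) = _
          rw [pmul_snoc_vertex, toGroup_app, toGroup_snoc, zero_mul]
        | snoc q e' =>
          rw [pmul_snoc_snoc, map_add, toGroup_app, toGroup_app, toGroup_snoc, zero_mul, add_zero]

theorem pathAssoc_of {x y z w t v : G} (p : APath ι x y) (q : APath ι z w) (r : APath ι t v) :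
    pathAssoc Φ ι (of k p ⊗ₜ (of k q ⊗ₜ of k r)) =
      if p.len = 0 ∧ q.len = 0 ∧ r.len = 0 then (Φ x z t : k) else 0 := by
  simp [pathAssoc, of]

/-- The reassociator of `H(M)` vanishes in positive length, so it is pulled back from `(kG, Φ)`. -/
theorem pathAssoc_eq (u v t : PathCoalgebra k ι) : pathAssoc Φ ι (u ⊗ₜ (v ⊗ₜ t)) =
    (groupMajid Φ).assoc (toGroup k ι u ⊗ₜ (toGroup k ι v ⊗ₜ toGroup k ι t)) := by
  induction u using PathCoalgebra.path_induction with
  | zero => simp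
  | add u u' h h' => simp only [TensorProduct.add_tmul, map_add, h, h']
  | smul c u h => simp only [← TensorProduct.smul_tmul', map_smul, h]
  | path x y p =>
    induction v using PathCoalgebra.path_induction with
    | zero => simp
    | add u u' h h' => simp only [TensorProduct.add_tmul, TensorProduct.tmul_add, map_add, h, h']
    | smul c u h =>
      simp only [← TensorProduct.smul_tmul', TensorProduct.tmul_smul, map_smul, h]
    | path z w q =>
      induction t using PathCoalgebra.path_induction with
      | zero => simp
      | add u u' h h' => simp only [TensorProduct.tmul_add, map_add, h, h']
      | smul c u h => simp only [TensorProduct.tmul_smul, map_smul, h]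
      | path t v r =>
        have e : ∀ {x y : G} (p : APath ι x y), toGroup k ι (of k p) =
          if p.len = 0 then grp k x else 0 := toGroupLin_of
        rw [pathAssoc_of, e, e, e]
        by_cases hp : p.len = 0 <;> by_cases hq : q.len = 0 <;> by_cases hr : r.len = 0 <;>
          simp [hp, hq, hr]
        exact (groupMajid_assoc Φ x z t).symm

theorem isHom_toGroup : MajidData.IsHom (B.pathMajid b) (groupMajid Φ) (toGroup k ι) where
  map_one := toGroup_vertex 1
  map_mul := toGroup_pmul b
  map_assoc := pathAssoc_eq

/-- Every path is, up to a vertex, obtained by appending an arrow to a shorter path. -/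
theorem exists_eq_vertex_add_app {x z : G} (p : APath ι x z) :
    ∃ (c : k) (u : PathCoalgebra k ι) (y : G) (m : M), m ∈ B.comp z y ∧
      of k p = c • vertex k ι z + B.app b z u m ∧
      (u = 0 ∨ ∃ p' : APath ι x y, u = of k p' ∧ p'.len < p.len) := by
  cases p with
  -- A vertex has no last arrow: `u` and `m` are zero, and the degree `y = 1` is arbitrary.
  | triv => exact ⟨1, 0, 1, 0, zero_mem _, by simp [vertex], Or.inl rfl⟩
  | snoc p e =>
    exact ⟨0, of k p, _, b _ _ e, (b _ _ e).2, by rw [app_of_basis, zero_smul, zero_add],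
      Or.inr ⟨p, rfl, by simp [APath.len]⟩⟩

/-- The product of two elements, in terms of their last arrows. -/
theorem pmul_eq {z w y₁ y₂ y₃ y₄ : G} {c c' : k} {p q u₁ u₂ u₃ u₄ : PathCoalgebra k ι}
    {m₁ m₂ m₃ m₄ : M} (h₁ : m₁ ∈ B.comp z y₁) (h₂ : m₂ ∈ B.comp z y₂) (h₃ : m₃ ∈ B.comp w y₃)
    (h₄ : m₄ ∈ B.comp w y₄)
    (hp : p = c • vertex k ι z + (B.app b z u₁ m₁ + B.app b z u₂ m₂))
    (hq : q = c' • vertex k ι w + (B.app b w u₃ m₃ + B.app b w u₄ m₄)) :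
    B.pmul b p q = (c * c') • vertex k ι (z * w) +
      (B.app b (z * w) (B.pmul b u₁ q) (B.ract w m₁) +
        B.app b (z * w) (B.pmul b u₂ q) (B.ract w m₂)) +
      (B.app b (z * w) (B.pmul b p u₃) (B.lact z m₃) +
        B.app b (z * w) (B.pmul b p u₄) (B.lact z m₄)) := by
  -- Two appended terms are allowed on each side because the last arrow of a product comes from
  -- either factor. The formula thus applies again to a factor that is itself a product.
  have e1 : ∀ {y : G} (u : PathCoalgebra k ι) {m : M}, m ∈ B.comp z y →
      B.pmul b (B.app b z u m) q = B.app b (z * w) (B.pmul b u q) (B.ract w m) +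
        (B.app b (z * w) (B.pmul b (B.app b z u m) u₃) (B.lact z m₃) +
        B.app b (z * w) (B.pmul b (B.app b z u m) u₄) (B.lact z m₄)) := by
    intro y u m hm
    simp only [hq, map_add, map_smul, LinearMap.add_apply, LinearMap.smul_apply,
      pmul_app_vertex b u hm, pmul_app_app b u _ hm h₃, pmul_app_app b u _ hm h₄]
    abel
  have e2 : B.pmul b (vertex k ι z) q = c' • vertex k ι (z * w) +
      (B.app b (z * w) (B.pmul b (vertex k ι z) u₃) (B.lact z m₃) +
        B.app b (z * w) (B.pmul b (vertex k ι z) u₄) (B.lact z m₄)) := by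
    simp only [hq, map_add, map_smul, pmul_vertex_vertex, pmul_vertex_app b _ h₃,
      pmul_vertex_app b _ h₄]
  have e3 : B.pmul b p q = c • B.pmul b (vertex k ι z) q +
      (B.pmul b (B.app b z u₁ m₁) q + B.pmul b (B.app b z u₂ m₂) q) := by
    simp only [hp, map_add, map_smul, LinearMap.add_apply, LinearMap.smul_apply]
  rw [e3, e1 u₁ h₁, e1 u₂ h₂, e2]
  simp only [hp, map_add, map_smul, LinearMap.add_apply, LinearMap.smul_apply, smul_add, mul_smul]
  abel

theorem pmul_eq_single {z w y₁ y₃ : G} {c c' : k} {p q u₁ u₃ : PathCoalgebra k ι}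
    {m₁ m₃ : M} (h₁ : m₁ ∈ B.comp z y₁) (h₃ : m₃ ∈ B.comp w y₃)
    (hp : p = c • vertex k ι z + B.app b z u₁ m₁)
    (hq : q = c' • vertex k ι w + B.app b w u₃ m₃) :
    B.pmul b p q = (c * c') • vertex k ι (z * w) +
      (B.app b (z * w) (B.pmul b u₁ q) (B.ract w m₁) +
        B.app b (z * w) (B.pmul b p u₃) (B.lact z m₃)) := by
  have := pmul_eq b (u₁ := u₁) (u₂ := 0) (u₃ := u₃) (u₄ := 0) (c := c) (c' := c') h₁
    (zero_mem (B.comp z 1)) h₃ (zero_mem (B.comp w 1)) (hp.trans (by simp)) (hq.trans (by simp))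
  rw [this]
  simp [add_assoc]

/-- Both bracketings are sums of three terms, according to whether the last arrow comes from `p`,
`q` or `r`. What precedes that arrow agrees by induction on total length, and the last arrows agree
by the three bimodule axioms, which are strict for trivial `Φ`. -/
theorem pmul_assoc_path (hΦ : ∀ e f g, Φ e f g = 1) (n : ℕ) {x y z w t v : G} (p : APath ι x y)
    (q : APath ι z w) (r : APath ι t v) (hn : p.len + q.len + r.len ≤ n) :
    B.pmul b (B.pmul b (of k p) (of k q)) (of k r) =
      B.pmul b (of k p) (B.pmul b (of k q) (of k r)) := by
  induction n generalizing x y z w t v with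
  | zero =>
    cases p <;> cases q <;> cases r <;> simp [APath.len] at hn
    change B.pmul b (B.pmul b (vertex k ι _) (vertex k ι _)) (vertex k ι _) =
      B.pmul b (vertex k ι _) (B.pmul b (vertex k ι _) (vertex k ι _))
    simp only [pmul_vertex_vertex, mul_assoc]
  | succ n ih =>
    obtain ⟨c₁, u₁, y₁, m₁, h₁, hp, hu₁⟩ := exists_eq_vertex_add_app b p
    obtain ⟨c₂, u₂, y₂, m₂, h₂, hq, hu₂⟩ := exists_eq_vertex_add_app b q
    obtain ⟨c₃, u₃, y₃, m₃, h₃, hr, hu₃⟩ := exists_eq_vertex_add_app b r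
    have z1 : ∀ g : G, (0 : M) ∈ B.comp g 1 := fun g => zero_mem _
    have hpq := pmul_eq_single b h₁ h₂ hp hq
    have hqr := pmul_eq_single b h₂ h₃ hq hr
    -- The factor that is a product fills both slots of its side; the single path is padded with a
    -- zero term.
    have hL := pmul_eq b (c' := c₃) (u₃ := u₃) (u₄ := 0) (ract_mem h₁ w) (lact_mem h₂ y) h₃ (z1 _) hpq
      (hr.trans (by simp))
    have hR := pmul_eq b (c := c₁) (u₁ := u₁) (u₂ := 0) h₁ (z1 _) (ract_mem h₂ v) (lact_mem h₃ w)
      (hp.trans (by simp)) hqr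
    have i1 : B.pmul b (B.pmul b u₁ (of k q)) (of k r) =
        B.pmul b u₁ (B.pmul b (of k q) (of k r)) := by
      obtain rfl | ⟨p', rfl, hl⟩ := hu₁
      · simp
      · exact ih p' q r (by omega)
    have i2 : B.pmul b (B.pmul b (of k p) u₂) (of k r) =
        B.pmul b (of k p) (B.pmul b u₂ (of k r)) := by
      obtain rfl | ⟨p', rfl, hl⟩ := hu₂
      · simp
      · exact ih p p' r (by omega)
    have i3 : B.pmul b (B.pmul b (of k p) (of k q)) u₃ =
        B.pmul b (of k p) (B.pmul b (of k q) u₃) := by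
      obtain rfl | ⟨p', rfl, hl⟩ := hu₃
      · simp
      · exact ih p q p' (by omega)
    -- The bimodule axioms for the arrows coming from `p`, `q` and `r` respectively.
    have a1 := ract_ract_comp w v h₁
    have a2 := lact_ract_comp y v h₂
    have a3 := lact_lact_comp y w h₃
    simp only [hΦ, div_one, one_smul] at a1 a2 a3
    rw [hL, hR, i1, i2, i3, a1, a2, ← a3]
    simp only [mul_assoc, map_zero, LinearMap.zero_apply, add_zero]
    abel

theorem pmul_assoc (hΦ : ∀ e f g, Φ e f g = 1) (u v t : PathCoalgebra k ι) :
    B.pmul b (B.pmul b u v) t = B.pmul b u (B.pmul b v t) := by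
  induction u using PathCoalgebra.path_induction with
  | zero => simp
  | add u u' h h' => simp only [LinearMap.add_apply, map_add, h, h']
  | smul c u h => simp only [LinearMap.smul_apply, map_smul, h]
  | path x y p =>
    induction v using PathCoalgebra.path_induction with
    | zero => simp
    | add u u' h h' => simp only [LinearMap.add_apply, map_add, h, h']
    | smul c u h => simp only [LinearMap.smul_apply, map_smul, h]
    | path z w q =>
      induction t using PathCoalgebra.path_induction with
      | zero => simp
      | add u u' h h' => simp only [map_add, h, h']
      | smul c u h => simp only [map_smul, h]
      | path t v r => exact pmul_assoc_path b hΦ _ p q r le_rfl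

theorem pmul_one (u : PathCoalgebra k ι) : B.pmul b u (vertex k ι 1) = u := by
  induction u using PathCoalgebra.path_induction with
  | zero => simp
  | add u u' h h' => rw [map_add, LinearMap.add_apply, h, h']
  | smul c u h => rw [map_smul, LinearMap.smul_apply, h]
  | path x y p =>
    induction p with
    | triv =>
      refine (pmul_vertex_vertex b x 1).trans ?_
      rw [mul_one, vertex]
    | snoc p e ih => rw [pmul_snoc_vertex, ih, B.one_ract, mul_one, app_of_basis]

theorem one_pmul (u : PathCoalgebra k ι) : B.pmul b (vertex k ι 1) u = u := by
  induction u using PathCoalgebra.path_induction with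
  | zero => simp
  | add u u' h h' => rw [map_add, h, h']
  | smul c u h => rw [map_smul, h]
  | path x y p =>
    induction p with
    | triv =>
      refine (pmul_vertex_vertex b 1 x).trans ?_
      rw [one_mul, vertex]
    | snoc p e ih => rw [pmul_vertex_snoc, ih, B.one_lact, one_mul, app_of_basis]

/-- A splitting of the longer path either has trivial terminal piece `z`, or comes from a splitting
of the old path by appending the new arrow to the terminal piece. -/
theorem comul_app {z y : G} (u : PathCoalgebra k ι) {m : M} (hm : m ∈ B.comp z y) :
    comul (R := k) (B.app b z u m) = vertex k ι z ⊗ₜ B.app b z u m +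
      ((B.app b z).flip m).rTensor _ (comul (R := k) u) := by
  refine path_arrow_induction b (P := fun u m => comul (R := k) (B.app b z u m) =
    vertex k ι z ⊗ₜ B.app b z u m + ((B.app b z).flip m).rTensor _ (comul (R := k) u))
    ?_ ?_ ?_ ?_ ?_ ?_ ?_ u hm
  · intro x y' p e
    by_cases h : y' = y
    · subst h
      rw [app_of_basis, comul_snoc, comul_of, map_list_sum, List.map_map]
      congr 2
      refine List.map_congr_left fun t _ => ?_
      simp [app_of_basis]
    -- All terminal pieces end where `p` does, so the arrow matches none of them.
    · rw [app_of_ne b p (b z y e).2 h, comul_of, map_list_sum, List.map_map]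
      rw [List.sum_eq_zero]
      · simp
      · intro a ha
        obtain ⟨t, _, rfl⟩ := List.mem_map.1 ha
        simp [app_of_ne b t.2.1 (b z y e).2 h]
  · simp
  · simp
  · intro u v m h1 h2
    simp only [map_add, LinearMap.add_apply, h1, h2, TensorProduct.tmul_add]; abel
  · intro u v m h1 h2
    simp only [map_add, h1, h2, TensorProduct.tmul_add, LinearMap.rTensor_add,
      LinearMap.add_apply]; abel
  · intro c u m h
    simp only [map_smul, LinearMap.smul_apply, h, TensorProduct.tmul_smul, smul_add]
  · intro c u m h
    simp only [map_smul, LinearMap.smul_apply, h, TensorProduct.tmul_smul, smul_add,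
      LinearMap.rTensor_smul]

variable (B) in
/-- The multiplication of the tensor square of the path coalgebra. -/
def pmulTwo : PathCoalgebra k ι ⊗[k] PathCoalgebra k ι →ₗ[k]
    PathCoalgebra k ι ⊗[k] PathCoalgebra k ι →ₗ[k] PathCoalgebra k ι ⊗[k] PathCoalgebra k ι :=
  TensorProduct.map₂ (B.pmul b) (B.pmul b)

theorem pmulTwo_tmul (u v u' v' : PathCoalgebra k ι) :
    B.pmulTwo b (u ⊗ₜ v) (u' ⊗ₜ v') = B.pmul b u u' ⊗ₜ B.pmul b v v' :=
  rfl

theorem pmulTwo_eq_map (s t : PathCoalgebra k ι ⊗[k] PathCoalgebra k ι) :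
    B.pmulTwo b s t = TensorProduct.map (B.pathMulMap b) (B.pathMulMap b)
      (TensorProduct.AlgebraTensorModule.tensorTensorTensorComm k k k k _ _ _ _ (s ⊗ₜ t)) := by
  induction s with
  | zero => simp
  | add a b ha hb => simp only [TensorProduct.add_tmul, map_add, LinearMap.add_apply, ha, hb]
  | tmul u v =>
    induction t with
    | zero => simp
    | add a b ha hb => simp only [TensorProduct.tmul_add, map_add, ha, hb]
    | tmul u' v' => rw [pmulTwo_tmul]; rfl

theorem pmulTwo_app_vertex {z y : G} {m : M} (hm : m ∈ B.comp z y) (w : G)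
    (s : PathCoalgebra k ι ⊗[k] PathCoalgebra k ι) (q : PathCoalgebra k ι) :
    B.pmulTwo b (((B.app b z).flip m).rTensor _ s) (vertex k ι w ⊗ₜ q) =
      ((B.app b (z * w)).flip (B.ract w m)).rTensor _ (B.pmulTwo b s (vertex k ι w ⊗ₜ q)) := by
  induction s with
  | zero => simp
  | add a b ha hb => simp only [map_add, LinearMap.add_apply, ha, hb]
  | tmul u v =>
    simp only [LinearMap.rTensor_tmul, LinearMap.flip_apply, pmulTwo_tmul, pmul_app_vertex b u hm]

theorem pmulTwo_vertex_app {z y : G} {m : M} (hm : m ∈ B.comp z y) (w : G)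
    (s : PathCoalgebra k ι ⊗[k] PathCoalgebra k ι) (p : PathCoalgebra k ι) :
    B.pmulTwo b (vertex k ι w ⊗ₜ p) (((B.app b z).flip m).rTensor _ s) =
      ((B.app b (w * z)).flip (B.lact w m)).rTensor _ (B.pmulTwo b (vertex k ι w ⊗ₜ p) s) := by
  induction s with
  | zero => simp
  | add a b ha hb => simp only [map_add, ha, hb]
  | tmul u v =>
    simp only [LinearMap.rTensor_tmul, LinearMap.flip_apply, pmulTwo_tmul, pmul_vertex_app b u hm]

theorem pmulTwo_app_app {z y w y' : G} {m m' : M} (hm : m ∈ B.comp z y) (hm' : m' ∈ B.comp w y')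
    (s t : PathCoalgebra k ι ⊗[k] PathCoalgebra k ι) :
    B.pmulTwo b (((B.app b z).flip m).rTensor _ s) (((B.app b w).flip m').rTensor _ t) =
      ((B.app b (z * w)).flip (B.ract w m)).rTensor _
        (B.pmulTwo b s (((B.app b w).flip m').rTensor _ t)) +
      ((B.app b (z * w)).flip (B.lact z m')).rTensor _
        (B.pmulTwo b (((B.app b z).flip m).rTensor _ s) t) := by
  induction s with
  | zero => simp
  | add a b ha hb => simp only [map_add, LinearMap.add_apply, ha, hb]; abel
  | tmul u v =>
    induction t with
    | zero => simp
    | add a b ha hb => simp only [map_add, ha, hb]; abel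
    | tmul u' v' =>
      simp only [LinearMap.rTensor_tmul, LinearMap.flip_apply, pmulTwo_tmul,
        pmul_app_app b u u' hm hm', TensorProduct.add_tmul]

/-- As `z` is group-like, the vertex term is absorbed in `z ⊗ p`, and no case distinction between
vertices and longer paths is needed. -/
theorem comul_vertex_add_app {z y : G} {c : k} {p u : PathCoalgebra k ι} {m : M}
    (hm : m ∈ B.comp z y) (hp : p = c • vertex k ι z + B.app b z u m) :
    comul (R := k) p = vertex k ι z ⊗ₜ p +
      ((B.app b z).flip m).rTensor _ (comul (R := k) u) := by
  rw [hp, map_add, map_smul, comul_app b u hm, (isGroupLikeElem_vertex z).comul_eq_tmul_self,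
    TensorProduct.tmul_add, TensorProduct.tmul_smul, add_assoc]

/-- Both sides consist of the term `yw ⊗ pq` and the terms whose left factor ends with an arrow of
`p` or of `q`. The latter agree by induction on total length. No condition on `Φ` enters. -/
theorem comul_pmul_path (n : ℕ) {x y z w : G} (p : APath ι x y) (q : APath ι z w)
    (hn : p.len + q.len ≤ n) : comul (R := k) (B.pmul b (of k p) (of k q)) =
      B.pmulTwo b (comul (R := k) (of k p)) (comul (R := k) (of k q)) := by
  induction n generalizing x y z w with
  | zero =>
    cases p <;> cases q <;> simp [APath.len] at hn
    change comul (R := k) (B.pmul b (vertex k ι _) (vertex k ι _)) =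
      B.pmulTwo b (comul (R := k) (vertex k ι _)) (comul (R := k) (vertex k ι _))
    rw [pmul_vertex_vertex]
    simp only [(isGroupLikeElem_vertex _).comul_eq_tmul_self, pmulTwo_tmul, pmul_vertex_vertex]
  | succ n ih =>
    obtain ⟨c₁, u₁, y₁, m₁, h₁, hp, hu₁⟩ := exists_eq_vertex_add_app b p
    obtain ⟨c₂, u₂, y₂, m₂, h₂, hq, hu₂⟩ := exists_eq_vertex_add_app b q
    have i1 : comul (R := k) (B.pmul b u₁ (of k q)) =
        B.pmulTwo b (comul (R := k) u₁) (comul (R := k) (of k q)) := by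
      obtain rfl | ⟨p', rfl, hl⟩ := hu₁
      · simp
      · exact ih p' q (by omega)
    have i2 : comul (R := k) (B.pmul b (of k p) u₂) =
        B.pmulTwo b (comul (R := k) (of k p)) (comul (R := k) u₂) := by
      obtain rfl | ⟨p', rfl, hl⟩ := hu₂
      · simp
      · exact ih p p' (by omega)
    have hp' := comul_vertex_add_app b h₁ hp
    have hq' := comul_vertex_add_app b h₂ hq
    have hpq := pmul_eq_single b h₁ h₂ hp hq
    have e1 : comul (R := k) (B.pmul b (of k p) (of k q)) =
        vertex k ι (y * w) ⊗ₜ B.pmul b (of k p) (of k q) +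
        (((B.app b (y * w)).flip (B.ract w m₁)).rTensor _
          (B.pmulTwo b (comul (R := k) u₁) (comul (R := k) (of k q))) +
        ((B.app b (y * w)).flip (B.lact y m₂)).rTensor _
          (B.pmulTwo b (comul (R := k) (of k p)) (comul (R := k) u₂))) := by
      rw [← i1, ← i2]
      conv_lhs => rw [hpq]
      rw [map_add, map_add, map_smul, comul_app b _ (ract_mem h₁ w), comul_app b _ (lact_mem h₂ y),
        (isGroupLikeElem_vertex _).comul_eq_tmul_self]
      conv_rhs => rw [hpq]
      simp only [TensorProduct.tmul_add, TensorProduct.tmul_smul]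
      abel
    rw [e1, hp', hq']
    simp only [map_add, LinearMap.add_apply, pmulTwo_tmul, pmul_vertex_vertex,
      pmulTwo_app_vertex b h₁, pmulTwo_vertex_app b h₂, pmulTwo_app_app b h₁ h₂]
    abel

theorem comul_pmul (u v : PathCoalgebra k ι) : comul (R := k) (B.pmul b u v) =
    B.pmulTwo b (comul (R := k) u) (comul (R := k) v) := by
  induction u using PathCoalgebra.path_induction with
  | zero => simp
  | add u u' h h' => simp only [LinearMap.add_apply, map_add, h, h']
  | smul c u h => simp only [LinearMap.smul_apply, map_smul, h]
  | path x y p =>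
    induction v using PathCoalgebra.path_induction with
    | zero => simp
    | add u u' h h' => simp only [map_add, h, h']
    | smul c u h => simp only [map_smul, h]
    | path z w q => exact comul_pmul_path b _ p q le_rfl

/-- The path coalgebra of a Hopf bimodule is a bialgebra. -/
theorem isBialgebra_pathMajid (hΦ : ∀ e f g, Φ e f g = 1) : (B.pathMajid b).IsBialgebra where
  one_mul := one_pmul b
  mul_one := pmul_one b
  mul_assoc := pmul_assoc b hΦ
  counit_one := (isGroupLikeElem_vertex (k := k) (ι := ι) (1 : G)).counit_eq_one
  counit_mul u v := by
    rw [← CoalgHomClass.counit_comp_apply (toGroup k ι), (isHom_toGroup b).map_mul]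
    change counit (R := k) (toGroup k ι u * toGroup k ι v) = _
    simp
  comul_one := (isGroupLikeElem_vertex (k := k) (ι := ι) (1 : G)).comul_eq_tmul_self
  comul_mul u v := (comul_pmul b u v).trans (pmulTwo_eq_map b _ _)
  assoc_eq := TensorProduct.ext' fun u t => by
    induction t with
    | zero => simp
    | add s t hs ht => simp only [TensorProduct.tmul_add, map_add, hs, ht]
    | tmul v t =>
      induction u using PathCoalgebra.path_induction with
      | zero => simp
      | add u u' h h' => simp only [TensorProduct.add_tmul, map_add, h, h']
      | smul c u h => simp only [← TensorProduct.smul_tmul', map_smul, h]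
      | path x y p =>
        induction v using PathCoalgebra.path_induction with
        | zero => simp
        | add u u' h h' =>
          simp only [TensorProduct.add_tmul, TensorProduct.tmul_add, map_add, h, h']
        | smul c u h =>
          simp only [← TensorProduct.smul_tmul', TensorProduct.tmul_smul, map_smul, h]
        | path z w q =>
          induction t using PathCoalgebra.path_induction with
          | zero => simp
          | add u u' h h' => simp only [TensorProduct.tmul_add, map_add, h, h']
          | smul c u h => simp only [TensorProduct.tmul_smul, map_smul, h]
          | path t v r =>
            refine (pathAssoc_of p q r).trans ?_
            rw [TensorProduct.counit_tmul, TensorProduct.counit_tmul, counit_of, counit_of,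
              counit_of, hΦ]
            split_ifs <;> simp_all

end MajidBimodule

end PathBialgebra

/-! ### Gauge transformations of the path coalgebra -/

section PathTwist

variable {k G : Type*} [Field k] {ι : G → G → Type*}

theorem MajidData.ext {H : Type*} [AddCommGroup H] [Module k H] [Coalgebra k H]
    {D E : MajidData k H} (h1 : D.one = E.one) (h2 : D.mul = E.mul) (h3 : D.assoc = E.assoc) :
    D = E := by
  cases D; cases E; simp_all

/-- The one-variable formula applies in each factor, since the projections commute with the
interchange of the middle tensor factors. -/
theorem rTensor_map_toGroup_comul {x y z w : G} (p : APath ι x y) (q : APath ι z w) :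
    (TensorProduct.map (toGroupLin k ι) (toGroupLin k ι)).rTensor _
      (comul (R := k) (of k p ⊗ₜ[k] of k q)) =
      (grp k y ⊗ₜ grp k w) ⊗ₜ (of k p ⊗ₜ of k q) := by
  have h : ∀ s t : PathCoalgebra k ι ⊗[k] PathCoalgebra k ι,
      (TensorProduct.map (toGroupLin k ι) (toGroupLin k ι)).rTensor _
        (TensorProduct.AlgebraTensorModule.tensorTensorTensorComm k k k k _ _ _ _ (s ⊗ₜ t)) =
      TensorProduct.AlgebraTensorModule.tensorTensorTensorComm k k k k _ _ _ _
        ((toGroupLin k ι).rTensor _ s ⊗ₜ (toGroupLin k ι).rTensor _ t) := by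
    intro s t
    induction s with
    | zero => simp
    | add a b ha hb => simp only [TensorProduct.add_tmul, map_add, ha, hb]
    | tmul u v =>
      induction t with
      | zero => simp
      | add a b ha hb => simp only [TensorProduct.tmul_add, map_add, ha, hb]
      | tmul u' v' => simp
  rw [TensorProduct.comul_tmul, h, rTensor_toGroupLin_comul, rTensor_toGroupLin_comul]
  simp

theorem lTensor_map_toGroup_comul {x y z w : G} (p : APath ι x y) (q : APath ι z w) :
    (TensorProduct.map (toGroupLin k ι) (toGroupLin k ι)).lTensor _
      (comul (R := k) (of k p ⊗ₜ[k] of k q)) =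
      (of k p ⊗ₜ of k q) ⊗ₜ (grp k x ⊗ₜ grp k z) := by
  have h : ∀ s t : PathCoalgebra k ι ⊗[k] PathCoalgebra k ι,
      (TensorProduct.map (toGroupLin k ι) (toGroupLin k ι)).lTensor _
        (TensorProduct.AlgebraTensorModule.tensorTensorTensorComm k k k k _ _ _ _ (s ⊗ₜ t)) =
      TensorProduct.AlgebraTensorModule.tensorTensorTensorComm k k k k _ _ _ _
        ((toGroupLin k ι).lTensor _ s ⊗ₜ (toGroupLin k ι).lTensor _ t) := by
    intro s t
    induction s with
    | zero => simp
    | add a b ha hb => simp only [TensorProduct.add_tmul, map_add, ha, hb]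
    | tmul u v =>
      induction t with
      | zero => simp
      | add a b ha hb => simp only [TensorProduct.tmul_add, map_add, ha, hb]
      | tmul u' v' => simp
  rw [TensorProduct.comul_tmul, h, lTensor_toGroupLin_comul, lTensor_toGroupLin_comul]
  simp

/-- The left functional sees only the end points and the right one only the starting points; the map
in the middle sees the whole paths. -/
theorem convSandwich_toGroup {N : Type*} [AddCommGroup N] [Module k N]
    (φ ψ : MonoidAlgebra k G ⊗[k] MonoidAlgebra k G →ₗ[k] k)
    (f : PathCoalgebra k ι ⊗[k] PathCoalgebra k ι →ₗ[k] N) {x y z w : G} (p : APath ι x y)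
    (q : APath ι z w) :
    MajidData.convSandwich (φ ∘ₗ TensorProduct.map (toGroupLin k ι) (toGroupLin k ι)) f
      (ψ ∘ₗ TensorProduct.map (toGroupLin k ι) (toGroupLin k ι)) (of k p ⊗ₜ of k q) =
      (φ (grp k y ⊗ₜ grp k w) * ψ (grp k x ⊗ₜ grp k z)) • f (of k p ⊗ₜ of k q) := by
  have h1 : ∀ (g : PathCoalgebra k ι ⊗[k] PathCoalgebra k ι →ₗ[k] N) (t),
      TensorProduct.map (φ ∘ₗ TensorProduct.map (toGroupLin k ι) (toGroupLin k ι)) g t =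
      TensorProduct.map φ g
        ((TensorProduct.map (toGroupLin k ι) (toGroupLin k ι)).rTensor _ t) := by
    intro g t
    rw [LinearMap.map_rTensor]
  have h2 : ∀ t, TensorProduct.map f
        (ψ ∘ₗ TensorProduct.map (toGroupLin k ι) (toGroupLin k ι)) t =
      TensorProduct.map f ψ
        ((TensorProduct.map (toGroupLin k ι) (toGroupLin k ι)).lTensor _ t) := by
    intro t
    rw [LinearMap.map_lTensor]
  rw [MajidData.convSandwich, LinearMap.comp_apply, LinearMap.comp_apply, h1,
    rTensor_map_toGroup_comul, TensorProduct.map_tmul, LinearMap.comp_apply, LinearMap.comp_apply,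
    h2, lTensor_map_toGroup_comul]
  simp only [TensorProduct.map_tmul, LinearEquiv.coe_coe, TensorProduct.rid_tmul,
    TensorProduct.lid_tmul, mul_smul]

variable [Group G] {Φ : ThreeCocycle k G} {M : Type*} [AddCommGroup M] [Module k M]

namespace MajidBimodule

variable {B : MajidBimodule Φ M} (b : ∀ g h, Module.Basis (ι g h) k (B.comp g h))
  (F : GroupGauge k G)

/-- The bases of the isotypic components of `M`, as bases of those of `M_F`. -/
def twistBasis (g h : G) : Module.Basis (ι g h) k ((B.twist F).comp g h) := b g h

theorem coe_twistBasis {g h : G} (e : ι g h) : (twistBasis b F g h e : M) = b g h e := rfl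

/-- Appending depends only on the bicomodule structure, which twisting does not change. -/
theorem app_twist (z : G) : (B.twist F).app (twistBasis b F) z = B.app b z := rfl

/-- Each factor of a product term is an action on one arrow, rescaled in `M_F` by the quotient of
`F` at its start by `F` at its end. These quotients telescope, so every interleaving gets the same
scalar. -/
theorem pmul_twist {x y z w : G} (p : APath ι x y) (q : APath ι z w) :
    (B.twist F).pmul (twistBasis b F) (of k p) (of k q) =
      ((F x z / F y w : kˣ) : k) • B.pmul b (of k p) (of k q) := by
  have hl : ∀ (f : G) {z y : G} (e : ι z y), (B.twist F).lact f (b z y e) =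
      ((F f y / F f z : kˣ) : k) • B.lact f (b z y e) := fun f z y e =>
    twistLact_comp F f (b z y e).2
  have hr : ∀ (f : G) {z y : G} (e : ι z y), (B.twist F).ract f (b z y e) =
      ((F y f / F z f : kˣ) : k) • B.ract f (b z y e) := fun f z y e =>
    twistRact_comp F f (b z y e).2
  induction p generalizing z w with
  | triv =>
    change (B.twist F).pmul (twistBasis b F) (vertex k ι x) _ = _ • B.pmul b (vertex k ι x) _
    induction q with
    | triv =>
      refine (pmul_vertex_vertex (B := B.twist F) (twistBasis b F) x z).trans ?_
      refine Eq.trans ?_ (congrArg _ (pmul_vertex_vertex b x z).symm)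
      simp
    | snoc q e ih =>
      rw [pmul_vertex_snoc (B := B.twist F) (twistBasis b F), pmul_vertex_snoc, ih, coe_twistBasis, hl,
        app_twist]
      simp only [map_smul, LinearMap.smul_apply, smul_smul, ← Units.val_mul]
      congr 2
      simp
  | snoc p e ihp =>
    induction q with
    | triv =>
      refine (pmul_snoc_vertex (B := B.twist F) (twistBasis b F) p e z).trans ?_
      refine Eq.trans ?_ (congrArg _ (pmul_snoc_vertex b p e z).symm)
      rw [vertex, ihp, coe_twistBasis, hr, app_twist]
      simp only [map_smul, LinearMap.smul_apply, smul_smul, ← Units.val_mul]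
      congr 2
      simp
    | snoc q e' ihq =>
      rw [pmul_snoc_snoc (B := B.twist F) (twistBasis b F), pmul_snoc_snoc, ihp, ihq,
        coe_twistBasis, coe_twistBasis, hl, hr, app_twist]
      simp only [map_smul, LinearMap.smul_apply, smul_smul, ← Units.val_mul, smul_add]
      congr 3 <;> simp

variable (B) in
/-- The gauge transformation of `H(M)` obtained from a gauge transformation on `G`. -/
def pathGauge : (B.pathMajid b).Gauge := (F.toGauge Φ).comap (isHom_toGroup b)

/-- Both products rescale that of `H(M)` by `F` at the starting points over `F` at the end points,
and both reassociators are pulled back from `(kG, Φ_F)`. -/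
theorem twist_pathGauge :
    MajidData.twist (B.pathGauge b F) = (B.twist F).pathMajid (twistBasis b F) := by
  refine MajidData.ext rfl ?_ ?_
  · refine TensorProduct.ext (PathCoalgebra.hom_ext fun x y p => PathCoalgebra.hom_ext
      fun z w q => ?_)
    refine (convSandwich_toGroup ((F.toUnit⁻¹).val.ofConv) F.toUnit.val.ofConv (B.pathMulMap b)
      p q).trans ?_
    refine Eq.trans ?_ (pmul_twist b F p q).symm
    have h1 := F.toUnit_apply x z
    have h2 := (F.toGauge Φ).inv_apply_grp y w
    rw [GroupGauge.toGauge_toGroup] at h2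
    change (F.toUnit⁻¹).val.ofConv _ = _ at h2
    rw [h1, h2, div_eq_inv_mul, Units.val_mul]
    rfl
  · have e : (MajidData.twist (F.toGauge Φ)).assoc = (groupMajid (Φ.twist F)).assoc := by
      refine ((MonoidAlgebra.basis G k).tensorProduct ((MonoidAlgebra.basis G k).tensorProduct
        (MonoidAlgebra.basis G k))).ext fun ⟨e, f, g⟩ => ?_
      simp only [Module.Basis.tensorProduct_apply, MonoidAlgebra.basis_apply]
      refine (twist_groupMajid_assoc _ e f g).trans (Eq.trans ?_ (groupMajid_assoc _ e f g).symm)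
      simp only [ThreeCocycle.twist, differential, GroupGauge.toGauge_toGroup]
    refine TensorProduct.ext (LinearMap.ext fun u => TensorProduct.ext' fun v t => ?_)
    refine (((isHom_toGroup b).twist (F.toGauge Φ)).map_assoc u v t).trans ?_
    rw [e]
    exact (pathAssoc_eq u v t).symm

variable (B) in
/-- A sub Majid algebra of `H(M)` containing the vertices is gauge equivalent to a Hopf algebra if
`Φ_F` is trivial. -/
theorem gaugeEquivalentToHopf_of_twist_eq_one {W : Type u} [AddCommGroup W] [Module k W]
    [Coalgebra k W] {D : MajidData k W} {i : W →ₗc[k] PathCoalgebra k ι}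
    (hi : MajidData.IsHom D (B.pathMajid b) i) (inj : Function.Injective i)
    (hv : ∀ g, ∃ v, i v = vertex k ι g) (hF : ∀ e f g, Φ.twist F e f g = 1) :
    D.GaugeEquivalentToHopf := by
  have hE := hi.twist (B.pathGauge b F)
  rw [twist_pathGauge] at hE
  have hD := MajidData.IsBialgebra.of_injective hE inj
    (isBialgebra_pathMajid (B := B.twist F) (twistBasis b F) hF)
  choose v hv using hv
  -- Vertices multiply as in `G` also after the twist, so the identity map takes invertible values
  -- at them. This yields the antipode.
  have hvv : ∀ g : G, (MajidData.twist ((B.pathGauge b F).comap hi)).mul (v g ⊗ₜ v g⁻¹) =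
      (MajidData.twist ((B.pathGauge b F).comap hi)).one := by
    intro g
    apply inj
    rw [hE.map_mul, hv, hv, hE.map_one]
    refine (pmul_vertex_vertex (B := B.twist F) (twistBasis b F) g g⁻¹).trans ?_
    rw [mul_inv_cancel]; rfl
  obtain ⟨A, hA, hA', h⟩ := hD.exists_isIsomorphic_ofHopfAlgebra <| by
    let _ := hD.ring
    let _ := hD.algebra
    refine isUnit_of_isUnit_at_vertices inj hv fun g => isUnit_iff_exists.2 ⟨v g⁻¹, hvv g, ?_⟩
    have := hvv g⁻¹
    rwa [inv_inv] at this
  exact ⟨A, hA, hA', _, h⟩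

variable (B) in
/-- If a sub Majid algebra of `H(M)` containing the vertices is gauge equivalent to a Hopf algebra,
then some `Φ_F` is trivial. -/
theorem exists_twist_eq_one {W : Type u} [AddCommGroup W] [Module k W]
    [Coalgebra k W] {D : MajidData k W} {i : W →ₗc[k] PathCoalgebra k ι}
    (hi : MajidData.IsHom D (B.pathMajid b) i) (inj : Function.Injective i)
    (hv : ∀ g, ∃ v, i v = vertex k ι g) (hD : D.GaugeEquivalentToHopf) :
    ∃ F : GroupGauge k G, ∀ e f g, Φ.twist F e f g = 1 := by
  choose v hv using hv
  have hG : ∀ g, IsGroupLikeElem k (v g) := fun g =>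
    isGroupLikeElem_of_map_injective inj (by rw [hv]; exact isGroupLikeElem_vertex g)
  have hb : ∀ g, (MonoidAlgebra.basis G k).constr k v (grp k g) = v g := fun g => by
    rw [grp, ← MonoidAlgebra.basis_apply, Module.Basis.constr_basis]
  -- The embedding of `kG` by the vertices; it is a coalgebra morphism because these are group-like.
  let s : MonoidAlgebra k G →ₗc[k] W :=
    { (MonoidAlgebra.basis G k).constr k v with
      counit_comp := (MonoidAlgebra.basis G k).ext fun g => by
        change counit (R := k) ((MonoidAlgebra.basis G k).constr k v _) = _
        rw [Module.Basis.constr_basis, (hG g).counit_eq_one]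
        simp
      map_comp_comul := (MonoidAlgebra.basis G k).ext fun g => by
        change TensorProduct.map ((MonoidAlgebra.basis G k).constr k v)
          ((MonoidAlgebra.basis G k).constr k v) (comul (R := k) _) =
          comul (R := k) ((MonoidAlgebra.basis G k).constr k v _)
        rw [MonoidAlgebra.basis_apply, hb, (hG g).comul_eq_tmul_self,
          (isGroupLikeElem_grp g).comul_eq_tmul_self, TensorProduct.map_tmul, hb] }
  have hs : ∀ g, s (grp k g) = v g := hb
  have hvv : ∀ g h, D.mul (v g ⊗ₜ v h) = v (g * h) := fun g h => inj <| by
    rw [hi.map_mul, hv, hv, hv]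
    exact pmul_vertex_vertex b g h
  have hsD : MajidData.IsHom (groupMajid Φ) D s :=
    { map_one := (hs 1).trans (inj (by rw [hv, hi.map_one]; rfl))
      map_mul := fun x y => by
        have : s.toLinearMap ∘ₗ (groupMajid Φ).mul =
            D.mul ∘ₗ TensorProduct.map s.toLinearMap s.toLinearMap := grp_tmul_ext fun g h => by
          change s (grp k g * grp k h) = D.mul (s (grp k g) ⊗ₜ s (grp k h))
          rw [hs, hs, hvv, MonoidAlgebra.single_mul_single, mul_one, hs]
        exact LinearMap.congr_fun this (x ⊗ₜ y)
      map_assoc := fun x y z => by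
        -- The embedding is a section of the degree zero projection, so the reassociator of `W`
        -- restricts to `Φ`.
        have h0 : ∀ x, toGroup k ι (i (s x)) = x := by
          have : (toGroup k ι).toLinearMap ∘ₗ i.toLinearMap ∘ₗ s.toLinearMap = LinearMap.id :=
            (MonoidAlgebra.basis G k).ext fun g => by
              rw [MonoidAlgebra.basis_apply]
              change toGroup k ι (i (s (grp k g))) = grp k g
              rw [hs, hv, toGroup_vertex]
          exact LinearMap.congr_fun this
        rw [hi.map_assoc, (isHom_toGroup b).map_assoc, h0, h0, h0] }
  obtain ⟨A, _, _, γ, φ, -, -, hφ⟩ := hD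
  -- `F` is the restriction of `γ` to the vertices. The value of `Φ_F` is then a value of the
  -- twisted reassociator of `W`, which corresponds to the counit of the Hopf algebra.
  refine ⟨(γ.comap hsD).toGroup, fun e f g => Units.ext ?_⟩
  rw [← twist_groupMajid_assoc, (hsD.twist γ).map_assoc, ← hφ]
  have hc : ∀ g, counit (R := k) (φ (s (grp k g))) = 1 := fun g => by
    rw [CoalgHomClass.counit_comp_apply, hs, (hG g).counit_eq_one]
  change counit (R := k) _ = _
  simp [hc]

end MajidBimodule

end PathTwist

/-! ### The characterizations of 3-coboundaries -/

namespace MajidData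

variable {k H : Type*} [Field k] [AddCommGroup H] [Module k H] [Coalgebra k H] (D : MajidData k H)

theorem isHom_id : IsHom D D (CoalgHom.id k H) where
  map_one := rfl
  map_mul _ _ := rfl
  map_assoc _ _ _ := rfl

/-- The inclusion of a generated sub Majid algebra. -/
def adjoinSubtype (S : Set H) : D.adjoin S →ₗc[k] H where
  __ := (D.adjoin S).subtype
  counit_comp := rfl
  map_comp_comul := LinearMap.ext fun x => map_subComul (D.isSub_adjoin S).comul_mem x

theorem isHom_adjoinSubtype (S : Set H) : IsHom (D.generated S) D (D.adjoinSubtype S) where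
  map_one := rfl
  map_mul _ _ := rfl
  map_assoc _ _ _ := rfl

end MajidData

variable {k G : Type*} [Field k] [Group G] {Φ : ThreeCocycle k G}

theorem ThreeCocycle.trivial_eq_twist_iff {F : GroupGauge k G} :
    ThreeCocycle.trivial k G = Φ.twist F ↔ ∀ e f g, Φ.twist F e f g = 1 := by
  refine ⟨fun h e f g => by rw [← h]; rfl, fun h => ThreeCocycle.ext ?_⟩
  funext e f g
  exact (h e f g).symm

/-- Twisting multiplies by a differential, so the cochains on the two sides are inverse to each
other. A cochain with normalized differential is constant on pairs containing the unit, so rescaling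
by a constant, which has trivial differential, normalizes it. -/
theorem ThreeCocycle.isCoboundary_iff :
    Φ.IsCoboundary ↔ ∃ F : GroupGauge k G, ThreeCocycle.trivial k G = Φ.twist F := by
  simp only [ThreeCocycle.trivial_eq_twist_iff]
  constructor
  · rintro ⟨F, hF⟩
    -- Evaluating the normalized `Φ = ∂F` at `(1, 1, g)` gives `F 1 1 / F 1 g = 1`.
    have h1 : ∀ g, F 1 g = F 1 1 := fun g => by
      have h := hF 1 1 g
      rw [Φ.one_left, differential, one_mul, one_mul, eq_comm, div_eq_one, mul_left_inj] at h
      exact h.symm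
    have h2 : ∀ g, F g 1 = F 1 1 := fun g => by
      have h := hF g 1 1
      rw [Φ.one_right, differential, mul_one, mul_one, eq_comm, div_eq_one, mul_right_inj] at h
      exact h
    refine ⟨⟨fun e f => F 1 1 / F e f, fun g => by rw [h1 g, div_self'], fun g => by
      rw [h2 g, div_self']⟩, fun e f g => ?_⟩
    simp only [ThreeCocycle.twist, hF, differential]
    apply Units.ext
    simp only [Units.val_mul, Units.val_div_eq_div_val, Units.val_one]
    field_simp
  · rintro ⟨F, hF⟩
    refine ⟨fun e f => (F e f)⁻¹, fun e f g => ?_⟩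
    have h := hF e f g
    simp only [ThreeCocycle.twist] at h
    rw [eq_inv_of_mul_eq_one_right h]
    simp only [differential]
    apply Units.ext
    simp only [Units.val_mul, Units.val_div_eq_div_val, Units.val_inv_eq_inv_val]
    field_simp

/-! ### Twisting collections to families of linear representations -/

section Collections

variable {r : ConjClasses G → G} {V : ConjClasses G → Type w} [∀ C, AddCommGroup (V C)]
  [∀ C, Module k (V C)] {F : GroupGauge k G}

/-- The operators are those of the twisted collection: its 2-cocycles are derived from the trivial
3-cocycle, hence are 1. -/
theorem Collection.exists_linear (X : Collection Φ r V)
    (hF : ThreeCocycle.trivial k G = Φ.twist F) :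
    ∃ σ : ∀ C, Representation k (Cent (r C)) (V C),
      ∀ C g v, σ C g v = (F.mu (r C) g : k) • (X.rep C).ρ g v := by
  have h1 : ∀ C (e f : Cent (r C)), (Φ.twist F).tildeCent (r C) e f = 1 := fun C e f => by
    simp [← hF, ThreeCocycle.tildeCent, ThreeCocycle.tilde, ThreeCocycle.trivial]
  refine ⟨fun C =>
    { toFun := ((X.twist F).rep C).ρ
      map_one' := LinearMap.ext ((X.twist F).rep C).ρ_one
      map_mul' := fun e f => LinearMap.ext fun v => ?_ }, fun C g v => rfl⟩
  have := ((X.twist F).rep C).ρ_mul e f v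
  rw [h1, Units.val_one, one_smul] at this
  exact this.symm

theorem Collection.exists_gaugeEquivalent_ofLinear_iff (X : Collection Φ r V) :
    (∃ (V' : ConjClasses G → Type w) (_ : ∀ C, AddCommGroup (V' C)) (_ : ∀ C, Module k (V' C))
      (σ : ∀ C, Representation k (Cent (r C)) (V' C)),
      X.GaugeEquivalent (Collection.ofLinear σ)) ↔
    ∃ F : GroupGauge k G, ThreeCocycle.trivial k G = Φ.twist F := by
  refine ⟨fun ⟨_, _, _, _, F, hF, _⟩ => ⟨F, hF⟩, fun ⟨F, hF⟩ => ?_⟩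
  obtain ⟨σ, hσ⟩ := X.exists_linear hF
  refine ⟨V, inferInstance, inferInstance, σ, F, hF, fun C => ⟨LinearEquiv.refl k _, fun g v => ?_⟩⟩
  refine (hσ C g v).trans ?_
  simp [Collection.twist]

theorem Collection.exists_uniformlyProjEquivalent_ofLinear_iff (X : Collection Φ r V) :
    (∃ (V' : ConjClasses G → Type w) (_ : ∀ C, AddCommGroup (V' C)) (_ : ∀ C, Module k (V' C))
      (σ : ∀ C, Representation k (Cent (r C)) (V' C)),
      X.UniformlyProjEquivalent (Collection.ofLinear σ)) ↔
    ∃ F : GroupGauge k G, ThreeCocycle.trivial k G = Φ.twist F := by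
  refine ⟨fun ⟨_, _, _, _, F, hF, _⟩ => ⟨F, hF⟩, fun ⟨F, hF⟩ => ?_⟩
  obtain ⟨σ, hσ⟩ := X.exists_linear hF
  exact ⟨V, inferInstance, inferInstance, σ, F, hF, fun C => ⟨LinearEquiv.refl k _, hσ C⟩⟩

end Collections

/-! ### Gauge equivalence for bimodules and for `H(M)` and `B(M)` -/

namespace MajidBimodule

variable {M : Type w} [AddCommGroup M] [Module k M] (B : MajidBimodule Φ M)

/-- A general `Φ'` lets the equation be substituted, so that `M_F` becomes a bimodule over the
trivial cocycle. -/
theorem exists_gaugeEquivalent_twist {Φ' : ThreeCocycle k G} {F : GroupGauge k G}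
    (h : Φ' = Φ.twist F) : ∃ B' : MajidBimodule Φ' M, B.GaugeEquivalent B' := by
  subst h
  exact ⟨B.twist F, F, rfl, LinearEquiv.refl k M,
    fun m => (LinearMap.congr_fun (LinearMap.lTensor_id _ _) _).symm,
    fun m => (LinearMap.congr_fun (LinearMap.rTensor_id _ _) _).symm, fun _ _ => rfl, fun _ _ => rfl⟩

theorem exists_gaugeEquivalent_hopfBimodule_iff :
    (∃ (N : Type w) (_ : AddCommGroup N) (_ : Module k N)
      (B' : MajidBimodule (ThreeCocycle.trivial k G) N), B.GaugeEquivalent B') ↔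
    ∃ F : GroupGauge k G, ThreeCocycle.trivial k G = Φ.twist F :=
  ⟨fun ⟨_, _, _, _, F, hF, _⟩ => ⟨F, hF⟩, fun ⟨_, hF⟩ =>
    ⟨M, _, _, B.exists_gaugeEquivalent_twist hF⟩⟩

variable {ι : G → G → Type*} (b : ∀ g h, Module.Basis (ι g h) k (B.comp g h))

/-- Only the vertices matter, so one argument covers `H(M)`, `B(M)` and everything between. -/
theorem gaugeEquivalentToHopf_iff {W : Type u} [AddCommGroup W] [Module k W]
    [Coalgebra k W] {D : MajidData k W} {i : W →ₗc[k] PathCoalgebra k ι}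
    (hi : MajidData.IsHom D (B.pathMajid b) i) (inj : Function.Injective i)
    (hv : ∀ g, ∃ v, i v = vertex k ι g) :
    D.GaugeEquivalentToHopf ↔ ∃ F : GroupGauge k G, ThreeCocycle.trivial k G = Φ.twist F := by
  simp only [ThreeCocycle.trivial_eq_twist_iff]
  exact ⟨B.exists_twist_eq_one b hi inj hv,
    fun ⟨F, hF⟩ => B.gaugeEquivalentToHopf_of_twist_eq_one b F hi inj hv hF⟩

theorem pathMajid_gaugeEquivalentToHopf_iff : (B.pathMajid b).GaugeEquivalentToHopf ↔
    ∃ F : GroupGauge k G, ThreeCocycle.trivial k G = Φ.twist F :=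
  B.gaugeEquivalentToHopf_iff b (MajidData.isHom_id _) Function.injective_id fun _ => ⟨_, rfl⟩

theorem nicholsMajid_gaugeEquivalentToHopf_iff : (B.nicholsMajid b).GaugeEquivalentToHopf ↔
    ∃ F : GroupGauge k G, ThreeCocycle.trivial k G = Φ.twist F :=
  B.gaugeEquivalentToHopf_iff b ((B.pathMajid b).isHom_adjoinSubtype (lowDegree k ι))
    Subtype.val_injective fun g =>
      ⟨⟨vertex k ι g, (B.pathMajid b).subset_adjoin _ ⟨g, g, .triv, by simp [APath.len], rfl⟩⟩, rfl⟩

end MajidBimodule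

end QuasiQuantum

theorem corollary4p4 {k : Type*} [Field k] {G : Type*} [Group G]
    (Φ : QuasiQuantum.ThreeCocycle k G)
    {M : Type w} [AddCommGroup M] [Module k M] (B : QuasiQuantum.MajidBimodule Φ M)
    {ι : G → G → Type*} (b : ∀ g h, Module.Basis (ι g h) k (B.comp g h))
    (r : ConjClasses G → G) (hr : ∀ C, ConjClasses.mk (r C) = C) :
    List.TFAE [
      (B.pathMajid b).GaugeEquivalentToHopf,
      (B.nicholsMajid b).GaugeEquivalentToHopf,
      ∃ (N : Type w) (_ : AddCommGroup N) (_ : Module k N)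
        (B' : QuasiQuantum.MajidBimodule (QuasiQuantum.ThreeCocycle.trivial k G) N),
        B.GaugeEquivalent B',
      Φ.IsCoboundary,
      ∃ (V : ConjClasses G → Type w) (_ : ∀ C, AddCommGroup (V C)) (_ : ∀ C, Module k (V C))
        (σ : ∀ C, Representation k (QuasiQuantum.Cent (r C)) (V C)),
        (B.collection r).GaugeEquivalent (QuasiQuantum.Collection.ofLinear σ),
      ∃ (V : ConjClasses G → Type w) (_ : ∀ C, AddCommGroup (V C)) (_ : ∀ C, Module k (V C))
        (σ : ∀ C, Representation k (QuasiQuantum.Cent (r C)) (V C)),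
        (B.collection r).UniformlyProjEquivalent (QuasiQuantum.Collection.ofLinear σ)] := by
  have h1 := B.pathMajid_gaugeEquivalentToHopf_iff b
  have h2 := B.nicholsMajid_gaugeEquivalentToHopf_iff b
  have h3 := B.exists_gaugeEquivalent_hopfBimodule_iff
  have h4 := Φ.isCoboundary_iff
  have h5 := (B.collection r).exists_gaugeEquivalent_ofLinear_iff
  have h6 := (B.collection r).exists_uniformlyProjEquivalent_ofLinear_iff
  -- Each condition is equivalent to the existence of a normalized `F` trivializing `Φ`.
  refine List.tfae_of_forall (∃ F : QuasiQuantum.GroupGauge k G,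
    QuasiQuantum.ThreeCocycle.trivial k G = Φ.twist F) _ fun a ha => ?_
  simp only [List.mem_cons, List.not_mem_nil, or_false] at ha
  obtain rfl | rfl | rfl | rfl | rfl | rfl := ha
  exacts [h1, h2, h3, h4, h5, h6]
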